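/- All function spaces consist of real-valued Lebesgue measurable functions on $\mathbb R^+=(0,\infty)$, modulo equality a.e. For such $f$ let $f^*(t)=\inf\{s\ge 0:|\{|f|>s\}|\le t\}$ be its decreasing rearrangement, write $f\prec g$ if $\int_0^t f^*\le\int_0^t g^*$ for all $t>0$, and let $Sf(t)=\frac1t\int_0^t f(r)\,dr$. A rearrangement invariant (r.i.) space $X$ is the set of all $f$ with $\|f\|_X<\infty$, where $\|\cdot\|_X$ takes values in $[0,\infty]$ and satisfies: (P1) it is a norm; (P2) $f^*\le g^*$ implies $\|f\|_X\le\|g\|_X$; (P3) $0\le f_n\uparrow f$ a.e. implies $\|f_n\|_X\uparrow\|f\|_X$; (P4) $\|\chi_E\|_X<\infty$ if $|E|<\infty$; (P5) if $|E|<\infty$, there is $C_E<\infty$ with $\int_E|f|\le C_E\|f\|_X$ for all $f$. Its associate space $X'$ has the norm $\|h\|_{X'}=\sup\{\int_0^\infty|hf|:\|f\|_X\le1\}$. Let $X$ be an r.i. space and $T:X\to L^1+L^\infty$ a linear operator that has an associate operator $T':L^1\cap L^\infty\to X'$, that is, for each $g\in L^1\cap L^\infty$ there is $T'g\in X'$ with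 $\int_0^\infty (Tf)\,g=\int_0^\infty f\,T'g$ for all $f\in X$. More generally, for a measurable $g$, write $T'g$ for the (unique) $h\in X'$ such that $(Tf)g$ is integrable and $\int_0^\infty (Tf)\,g=\int_0^\infty f h$ for all $f\in X$, whenever such an $h$ exists. Assume that $T$ is of class $\mathcal H$, that is, on $L^1\cap L^\infty\subset X$: (i) $T$ maps positive decreasing functions to positive decreasing functions; (ii) $Tf\prec Tf^*$ for every $f$; (iii) $S\chi_{(0,t)}\le ST\chi_{(0,t)}$ for every $t>0$. (Positive means $\ge0$.) Let $$\mathfrak R[T,X]=\Big\{f\in L^1+L^\infty:\ \exists\lambda>0\ \ \forall g\downarrow\ \int_0^\infty f^*(t)g(t)\,dt\le\lambda\|T'g\|_{X'}\Big\},$$ with $\|f\|_{\mathfrak R[T,X]}$ the infimum of such $\lambda$ (and $\infty$ if $f\notin\mathfrak R[T,X]$), where $g\downarrow$ means that $g$ ranges over the positive decreasing functions for which $T'g$ is defined. Then $\mathfrak R[T,X]$ is an r.i. space, and it is the r.i. optimal range for $T$ on $X$: $T:X\to\mathfrak R[T,X]$ is bounded, and whenever $Y$ is an r.i. space such that $T:X\to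 Y$ is bounded, $\mathfrak R[T,X]\subset Y$ with continuous inclusion. Moreover, for every measurable $f$, $$\|f\|_{\mathfrak R[T,X]}=\sup_{g\downarrow}\frac{\int_0^\infty f^*(t)g(t)\,dt}{\|T'g\|_{X'}},$$ where $0/0=0$. -/

import Mathlib

open MeasureTheory Set
open scoped ENNReal NNReal

noncomputable section

/-- Lebesgue measure on `ℝ⁺ = (0, ∞)`, seen as a measure on `ℝ`. -/
abbrev muPos : Measure ℝ := volume.restrict (Ioi (0 : ℝ))

/-- Real-valued measurable functions on `(0, ∞)`, modulo equality almost everywhere. -/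
abbrev LZero : Type := ℝ →ₘ[muPos] ℝ

/-- The space `L¹ + L^∞`. -/
def LOneAddLInf : Submodule ℝ LZero :=
  Lp.LpSubmodule ℝ ℝ 1 muPos ⊔ Lp.LpSubmodule ℝ ℝ ∞ muPos

/-- The space `L¹ ∩ L^∞`. -/
def LOneInterLInf : Submodule ℝ LZero :=
  Lp.LpSubmodule ℝ ℝ 1 muPos ⊓ Lp.LpSubmodule ℝ ℝ ∞ muPos

/-- The distribution function `s ↦ |{x > 0 : |f x| > s}|`. -/
def distrib (f : LZero) (s : ℝ≥0∞) : ℝ≥0∞ := muPos {x | s < ‖f x‖ₑ}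

/-- The decreasing rearrangement `f*(t) = inf {s ≥ 0 : |{|f| > s}| ≤ t}`; it may take the
value `∞`. -/
def rearr (f : LZero) (t : ℝ) : ℝ≥0∞ := sInf {s : ℝ≥0∞ | distrib f s ≤ ENNReal.ofReal t}

/-- The Hardy–Littlewood–Pólya relation `f ≺ g`. -/
def HLP (f g : LZero) : Prop :=
  ∀ t : ℝ, 0 < t → ∫⁻ s in Ioo 0 t, rearr f s ≤ ∫⁻ s in Ioo 0 t, rearr g s

/-- The characteristic function of a measurable set `E`. -/
def chi (E : Set ℝ) (hE : MeasurableSet E) : LZero :=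
  AEEqFun.mk (E.indicator fun _ => (1 : ℝ))
    (measurable_const.indicator hE).aestronglyMeasurable

/-- Properties (P1)–(P5) of a rearrangement invariant Banach function norm over `(0, ∞)`. The
functional is defined on all measurable functions, with values in `[0, ∞]`. -/
structure IsRINorm (ρ : LZero → ℝ≥0∞) : Prop where
  eq_zero_iff : ∀ f, ρ f = 0 ↔ f = 0
  smul : ∀ (c : ℝ) (f : LZero), ρ (c • f) = ‖c‖ₑ * ρ f
  add_le : ∀ f g, ρ (f + g) ≤ ρ f + ρ g
  rearr_mono : ∀ f g, (∀ t : ℝ, 0 < t → rearr f t ≤ rearr g t) → ρ f ≤ ρ g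
  fatou : ∀ (u : ℕ → LZero) (f : LZero), 0 ≤ u 0 → Monotone u →
    (∀ᵐ x ∂muPos, Filter.Tendsto (fun n => u n x) Filter.atTop (nhds (f x))) →
    Monotone (fun n => ρ (u n)) ∧
      Filter.Tendsto (fun n => ρ (u n)) Filter.atTop (nhds (ρ f))
  chi_lt_top : ∀ (E : Set ℝ) (hE : MeasurableSet E), muPos E < ∞ → ρ (chi E hE) < ∞
  lintegral_le : ∀ E : Set ℝ, MeasurableSet E → muPos E < ∞ →
    ∃ C : ℝ≥0, ∀ f, ∫⁻ x in E, ‖f x‖ₑ ∂muPos ≤ C * ρ f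

/-- A rearrangement invariant (r.i.) space over `(0, ∞)`, given by its norm. -/
structure RISpace where
  nrm : LZero → ℝ≥0∞
  isRINorm : IsRINorm nrm

/-- The functions belonging to an r.i. space: those of finite norm. -/
def RISpace.carrier (X : RISpace) : Submodule ℝ LZero where
  carrier := {f | X.nrm f < ∞}
  zero_mem' := by
    have h : X.nrm 0 = 0 := (X.isRINorm.eq_zero_iff 0).2 rfl
    simp [h]
  add_mem' := fun {a b} ha hb =>
    (X.isRINorm.add_le a b).trans_lt (ENNReal.add_lt_top.2 ⟨ha, hb⟩)
  smul_mem' := fun c f hf => by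
    have hf' : X.nrm f < ∞ := hf
    have h : X.nrm (c • f) < ∞ := by
      rw [X.isRINorm.smul]
      exact ENNReal.mul_lt_top enorm_lt_top hf'
    exact h

/-- The norm of the associate space `X'`. -/
def RISpace.assocNorm (X : RISpace) (h : LZero) : ℝ≥0∞ :=
  ⨆ (f : LZero) (_ : X.nrm f ≤ 1), ∫⁻ x, ‖h x * f x‖ₑ ∂muPos

/-- `f` is (almost everywhere equal to) a positive decreasing function on `(0, ∞)`. -/
def IsPosDecreasing (f : LZero) : Prop :=
  ∃ φ : ℝ → ℝ, AntitoneOn φ (Ioi 0) ∧ (∀ t ∈ Ioi (0 : ℝ), 0 ≤ φ t) ∧ f =ᵐ[muPos] φ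

/-- The Hardy operator `S f (s) = (1 / s) ∫₀ˢ f`. -/
def hardy (f : LZero) (s : ℝ) : ℝ := s⁻¹ * ∫ r in Ioo 0 s, f r

/-- `T` is of class `𝓗`: on `L¹ ∩ L^∞` (which is contained in every r.i. space) it is
decreasing, HLP-monotone, and satisfies a restricted lower estimate. -/
structure IsClassH (X : RISpace) (T : X.carrier →ₗ[ℝ] LOneAddLInf) : Prop where
  decreasing : ∀ f : X.carrier, (f : LZero) ∈ LOneInterLInf →
    IsPosDecreasing f → IsPosDecreasing (T f)
  hlp_monotone : ∀ f fstar : X.carrier, (f : LZero) ∈ LOneInterLInf →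
    (fstar : LZero) =ᵐ[muPos] (fun t => (rearr f t).toReal) → HLP (T f) (T fstar)
  restricted_lower : ∀ t : ℝ, 0 < t → ∀ f : X.carrier,
    (f : LZero) = chi (Ioo 0 t) measurableSet_Ioo →
    ∀ s : ℝ, 0 < s → hardy f s ≤ hardy (T f) s

/-- `T' g = h`: the function `h` belongs to `X'` and `∫ (T f) g = ∫ f h` for every `f ∈ X`, the
left-hand integral being absolutely convergent. (That of the right-hand one follows from
`h ∈ X'`.) Such an `h` is unique. -/
def IsAssociate (X : RISpace) (T : X.carrier →ₗ[ℝ] LOneAddLInf) (g h : LZero) : Prop :=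
  X.assocNorm h < ∞ ∧ ∀ f : X.carrier,
    Integrable (fun x => (T f : LZero) x * g x) muPos ∧
      ∫ x, (T f : LZero) x * g x ∂muPos = ∫ x, (f : LZero) x * h x ∂muPos

/-- `T : X → L¹ + L^∞` has an associate operator `T' : L¹ ∩ L^∞ = (L¹ + L^∞)' → X'`. -/
def HasAssociateOperator (X : RISpace) (T : X.carrier →ₗ[ℝ] LOneAddLInf) : Prop :=
  ∀ g ∈ LOneInterLInf, ∃ h, IsAssociate X T g h

/-- `∫₀^∞ f* g ≤ c ‖T' g‖_{X'}` for every positive decreasing `g` for which `T' g` is defined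
in `X'`. -/
def RangeBound (X : RISpace) (T : X.carrier →ₗ[ℝ] LOneAddLInf) (f : LZero) (c : ℝ≥0) : Prop :=
  ∀ g h : LZero, IsPosDecreasing g → IsAssociate X T g h →
    ∫⁻ t in Ioi 0, rearr f t * ‖g t‖ₑ ≤ c * X.assocNorm h

/-- The space `𝕽[T, X]`. -/
def rangeSpace (X : RISpace) (T : X.carrier →ₗ[ℝ] LOneAddLInf) : Set LZero :=
  {f | f ∈ LOneAddLInf ∧ ∃ c : ℝ≥0, 0 < c ∧ RangeBound X T f c}

/-- The norm of `𝕽[T, X]`, equal to `∞` outside that space. -/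
def rangeNorm (X : RISpace) (T : X.carrier →ₗ[ℝ] LOneAddLInf) (f : LZero) : ℝ≥0∞ :=
  ⨅ (c : ℝ≥0) (_ : f ∈ LOneAddLInf ∧ 0 < c ∧ RangeBound X T f c), (c : ℝ≥0∞)

/-- `T` maps `X` boundedly into the r.i. space `Y`. -/
def BoundedInto (X : RISpace) (T : X.carrier →ₗ[ℝ] LOneAddLInf) (Y : RISpace) : Prop :=
  ∃ C : ℝ≥0, ∀ f : X.carrier, Y.nrm (T f) ≤ C * X.nrm f

/-- `Z` is the r.i. optimal range of `T` on `X`: the smallest r.i. space (for continuous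
inclusion) into which `T` maps `X` boundedly. -/
def IsRIOptimalRange (X : RISpace) (T : X.carrier →ₗ[ℝ] LOneAddLInf) (Z : RISpace) : Prop :=
  BoundedInto X T Z ∧ ∀ Y : RISpace, BoundedInto X T Y →
    Z.carrier ≤ Y.carrier ∧ ∃ K : ℝ≥0, ∀ f ∈ Z.carrier, Y.nrm f ≤ K * Z.nrm f

end

/-!
# The rearrangement invariant optimal range of an operator of class `𝓗`

For decreasing `g`, the layer cake formula writes `∫ a g` as a mixture of the integrals of `a` over
initial intervals (`hardy_lemma`, and `hardy_liminf` for lower limits). Everything about `f*` that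
is needed on initial intervals follows from the formula
`∫₀ᵗ f* = min_s (∫ (|f| - s)⁺ + s t)`, attained at `s = f* (t)` (`lintegral_rearr_le`,
`lintegral_tsub_add_le_lintegral_rearr`): the subadditivity of `f ↦ ∫₀ᵗ f*`, and the fact that
`∫₀ᵗ f*` is the supremum of `∫_E |f|` over the sets `E` of measure at most `t`.

*The range is an r.i. space.* Its norm is the supremum of the quotients `∫ f* g / ‖T' g‖`
(`rangeNorm_eq_iSup`), from which the axioms are read off. Only the finiteness of the norm of a
characteristic function involves the class `𝓗`: `S χ ≤ S T χ` and Hardy's lemma give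
`∫ χ g ≤ ∫ (T χ) g = ∫ χ T' g`.

*`T` is bounded into it.* For bounded `f` with bounded support,
`∫ (T f)* g ≤ ∫ (T f*) g = ∫ f* T' g ≤ ‖f‖ ‖T' g‖`. The truncations `fₙ` of a general `f` satisfy
`T fₙ → T f` weakly against `L¹ ∩ L^∞`, because `T` has an associate operator, and `f ↦ ∫₀ᵗ f*` is
weakly lower semicontinuous, being a supremum of integrals (`rangeNorm_apply_le`).

*It is optimal.* Suppose that `T : X → Y` has norm `C`. If `g` is decreasing, in `L¹ ∩ L^∞`, and in
the unit ball of the associate space of `Y`, then `‖T' g‖ ≤ C` (`IsAssociate.assocNorm_le`), so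
`∫ f* g ≤ C ‖f‖` with the norm of the range on the right. It remains to recover the norm of `Y` from
such `g`. By the Fatou property `f*` may be replaced by a decreasing step function on a uniform
grid, and the finite-dimensional Hahn-Banach theorem yields a norming functional, whose
coefficients may be sorted since the norm is invariant under permutations of the cells
(`IsRINorm.exists_dual_vector`). The resulting step function `g` is in the unit ball of the
associate space on all of `Y`, and not merely on step functions of the same grid, because averaging
over cells is a contraction: on a refined grid, an average is a mean of permutations
(`IsRINorm.blockAvg_le`, `IsRINorm.lintegral_rearr_mul_stepFin_le`).
-/

noncomputable section

open Filter Topology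

/-! ### Layer cake formula -/

theorem lintegral_eq_lintegral_meas_ofReal_lt {α : Type*} [MeasurableSpace α] (μ : Measure α)
    {u : α → ℝ≥0∞} (hu : AEMeasurable u μ) :
    ∫⁻ x, u x ∂μ = ∫⁻ s in Ioi (0 : ℝ), μ {x | ENNReal.ofReal s < u x} := by
  by_cases h : ∀ᵐ x ∂μ, u x ≠ ∞
  · have h1 := lintegral_eq_lintegral_meas_lt μ (f := fun x => (u x).toReal)
      (ae_of_all _ fun _ => ENNReal.toReal_nonneg) hu.ennreal_toReal
    have h2 : ∫⁻ x, ENNReal.ofReal (u x).toReal ∂μ = ∫⁻ x, u x ∂μ := by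
      apply lintegral_congr_ae
      filter_upwards [h] with x hx
      exact ENNReal.ofReal_toReal hx
    rw [← h2, h1]
    refine setLIntegral_congr_fun measurableSet_Ioi fun s hs => ?_
    apply measure_congr
    filter_upwards [h] with x hx
    apply propext
    change s < (u x).toReal ↔ ENNReal.ofReal s < u x
    exact (ENNReal.ofReal_lt_iff_lt_toReal (le_of_lt hs) hx).symm
  · have h0 : μ {x | u x = ∞} ≠ 0 := by
      intro h0
      exact h (by rw [ae_iff]; simpa using h0)
    have h1 : ∫⁻ x, u x ∂μ = ∞ := by
      by_contra h2
      exact h ((ae_lt_top' hu h2).mono fun x hx => hx.ne)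
    rw [h1]
    symm
    rw [eq_top_iff]
    calc (∞ : ℝ≥0∞) = ∫⁻ s in Ioi (0 : ℝ), μ {x | u x = ∞} := by
          simp [ENNReal.mul_top h0]
      _ ≤ _ := by
          refine lintegral_mono fun s => measure_mono fun x hx => ?_
          have hx' : u x = ∞ := hx
          simp [hx']

/-! ### The decreasing rearrangement -/

theorem aemeasurable_enorm (f : LZero) : AEMeasurable (fun x => ‖f x‖ₑ) muPos :=
  f.aestronglyMeasurable.enorm

theorem distrib_antitone (f : LZero) : Antitone (distrib f) := fun _ _ hab =>
  measure_mono fun _ hx => lt_of_le_of_lt hab hx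

theorem rearr_antitone (f : LZero) : Antitone (rearr f) := fun _ _ hab =>
  sInf_le_sInf fun _ hs => le_trans hs (ENNReal.ofReal_le_ofReal hab)

theorem rearr_measurable (f : LZero) : Measurable (rearr f) :=
  (rearr_antitone f).measurable

/-- The infimum that defines the rearrangement is attained, by continuity of the measure. -/
theorem distrib_rearr_le (f : LZero) (t : ℝ) : distrib f (rearr f t) ≤ ENNReal.ofReal t := by
  have hne : {s : ℝ≥0∞ | distrib f s ≤ ENNReal.ofReal t}.Nonempty := ⟨∞, by simp [distrib]⟩
  obtain ⟨u, hu, hlim, hmem⟩ := exists_seq_tendsto_sInf hne (OrderBot.bddBelow _)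
  have hsub : {x | rearr f t < ‖f x‖ₑ} ⊆ ⋃ n, {x | u n < ‖f x‖ₑ} := by
    intro x hx
    obtain ⟨n, hn⟩ := (hlim.eventually (gt_mem_nhds hx)).exists
    exact mem_iUnion.2 ⟨n, hn⟩
  have hmono : Monotone fun n => {x | u n < ‖f x‖ₑ} := fun a b hab x hx =>
    lt_of_le_of_lt (hu hab) hx
  calc distrib f (rearr f t) ≤ muPos (⋃ n, {x | u n < ‖f x‖ₑ}) := measure_mono hsub
    _ = ⨆ n, muPos {x | u n < ‖f x‖ₑ} := hmono.measure_iUnion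
    _ ≤ _ := iSup_le fun n => hmem n

theorem rearr_le_iff (f : LZero) (t : ℝ) (s : ℝ≥0∞) :
    rearr f t ≤ s ↔ distrib f s ≤ ENNReal.ofReal t :=
  ⟨fun h => (distrib_antitone f h).trans (distrib_rearr_le f t), fun h => sInf_le h⟩

theorem lt_rearr_iff (f : LZero) (t : ℝ) (s : ℝ≥0∞) :
    s < rearr f t ↔ ENNReal.ofReal t < distrib f s := by
  rw [← not_le, rearr_le_iff, not_le]

theorem muPos_ofReal_lt (a : ℝ≥0∞) : muPos {t | ENNReal.ofReal t < a} = a := by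
  rw [Measure.restrict_apply (measurableSet_lt ENNReal.measurable_ofReal measurable_const)]
  rcases eq_or_ne a ∞ with rfl | ha
  · simp
  · have : {t : ℝ | ENNReal.ofReal t < a} ∩ Ioi 0 = Ioo 0 a.toReal := by
      ext t
      simp only [mem_inter_iff, mem_ofPred_eq, mem_Ioi, mem_Ioo]
      constructor
      · rintro ⟨h1, h2⟩
        exact ⟨h2, (ENNReal.ofReal_lt_iff_lt_toReal h2.le ha).1 h1⟩
      · rintro ⟨h1, h2⟩
        exact ⟨(ENNReal.ofReal_lt_iff_lt_toReal h1.le ha).2 h2, h1⟩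
    rw [this, Real.volume_Ioo, sub_zero, ENNReal.ofReal_toReal ha]

/-- A function and its decreasing rearrangement are equimeasurable. -/
theorem muPos_lt_rearr (f : LZero) (s : ℝ≥0∞) : muPos {t | s < rearr f t} = distrib f s := by
  simp_rw [lt_rearr_iff]
  exact muPos_ofReal_lt _

theorem rearr_congr_distrib {f g : LZero} (h : ∀ s, distrib f s = distrib g s) :
    rearr f = rearr g := by
  funext t
  simp only [rearr, h]

theorem distrib_le_of_enorm_le {f : LZero} {v : ℝ → ℝ≥0∞} (h : ∀ᵐ x ∂muPos, ‖f x‖ₑ ≤ v x)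
    (s : ℝ≥0∞) : distrib f s ≤ muPos {x | s < v x} := by
  apply measure_mono_ae
  filter_upwards [h] with x hx hs
  exact lt_of_lt_of_le hs hx

theorem distrib_mono {f g : LZero} (h : ∀ᵐ x ∂muPos, ‖f x‖ₑ ≤ ‖g x‖ₑ) (s : ℝ≥0∞) :
    distrib f s ≤ distrib g s :=
  distrib_le_of_enorm_le h s

theorem rearr_le_of_distrib_le {f g : LZero} (h : ∀ s, distrib f s ≤ distrib g s) (t : ℝ) :
    rearr f t ≤ rearr g t :=
  sInf_le_sInf fun s hs => (h s).trans hs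

theorem rearr_mono {f g : LZero} (h : ∀ᵐ x ∂muPos, ‖f x‖ₑ ≤ ‖g x‖ₑ) (t : ℝ) :
    rearr f t ≤ rearr g t :=
  rearr_le_of_distrib_le (distrib_mono h) t

theorem rearr_le_of_enorm_le_rearr {f g : LZero} (h : ∀ᵐ x ∂muPos, ‖f x‖ₑ ≤ rearr g x) (t : ℝ) :
    rearr f t ≤ rearr g t :=
  rearr_le_of_distrib_le (fun s => (distrib_le_of_enorm_le h s).trans_eq (muPos_lt_rearr g s)) t

theorem rearr_eq_of_enorm_eq_rearr {f g : LZero} (h : ∀ᵐ x ∂muPos, ‖f x‖ₑ = rearr g x) :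
    rearr f = rearr g := by
  refine rearr_congr_distrib fun s => ?_
  rw [← muPos_lt_rearr g s]
  apply measure_congr
  filter_upwards [h] with x hx
  apply propext
  change s < ‖f x‖ₑ ↔ s < rearr g x
  rw [hx]

theorem rearr_zero (t : ℝ) : rearr 0 t = 0 := by
  rw [← le_zero_iff, rearr_le_iff]
  have : distrib 0 0 = 0 := by
    rw [distrib, ← nonpos_iff_eq_zero]
    refine (measure_mono_ae ?_).trans_eq measure_empty
    filter_upwards [AEEqFun.coeFn_zero (α := ℝ) (β := ℝ) (μ := muPos)] with x hx h
    have h' : (0 : ℝ≥0∞) < ‖(0 : LZero) x‖ₑ := h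
    simp [hx] at h'
  simp [this]

theorem rearr_smul_le (c : ℝ) (f : LZero) (t : ℝ) : rearr (c • f) t ≤ ‖c‖ₑ * rearr f t := by
  rw [rearr_le_iff]
  refine le_trans (measure_mono_ae ?_) (distrib_rearr_le f t)
  filter_upwards [AEEqFun.coeFn_smul c f] with x hx h
  have h' : ‖c‖ₑ * rearr f t < ‖(c • f : LZero) x‖ₑ := h
  rw [hx, Pi.smul_apply, smul_eq_mul, enorm_mul] at h'
  exact lt_of_mul_lt_mul_left' h'

theorem rearr_smul (c : ℝ) (f : LZero) (t : ℝ) : rearr (c • f) t = ‖c‖ₑ * rearr f t := by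
  refine le_antisymm (rearr_smul_le c f t) ?_
  rcases eq_or_ne c 0 with rfl | hc
  · simp
  · have h1 := rearr_smul_le c⁻¹ (c • f) t
    rw [smul_smul, inv_mul_cancel₀ hc, one_smul] at h1
    calc ‖c‖ₑ * rearr f t ≤ ‖c‖ₑ * (‖c⁻¹‖ₑ * rearr (c • f) t) := by gcongr
      _ = rearr (c • f) t := by
        rw [← mul_assoc, ← enorm_mul, mul_inv_cancel₀ hc]
        simp

/-- Rearrangement commutes with increasing limits. -/
theorem rearr_eq_iSup {u : ℕ → LZero} {f : LZero} (hmono : ∀ᵐ x ∂muPos, Monotone fun n => ‖u n x‖ₑ)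
    (hlim : ∀ᵐ x ∂muPos, Tendsto (fun n => ‖u n x‖ₑ) atTop (𝓝 ‖f x‖ₑ)) (t : ℝ) :
    rearr f t = ⨆ n, rearr (u n) t := by
  have hsup : ∀ᵐ x ∂muPos, ‖f x‖ₑ = ⨆ n, ‖u n x‖ₑ := by
    filter_upwards [hmono, hlim] with x h1 h2
    exact tendsto_nhds_unique h2 (tendsto_atTop_iSup h1)
  apply le_antisymm
  · rw [rearr_le_iff]
    set s := ⨆ n, rearr (u n) t
    have hm : ∀ i, NullMeasurableSet {x | s < ‖u i x‖ₑ} muPos := fun i =>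
      nullMeasurableSet_lt aemeasurable_const (aemeasurable_enorm (u i))
    have h1 : distrib f s ≤ muPos (⋃ n, {x | s < ‖u n x‖ₑ}) := by
      apply measure_mono_ae
      filter_upwards [hsup] with x hx h
      have h' : s < ‖f x‖ₑ := h
      rw [hx, lt_iSup_iff] at h'
      exact mem_iUnion.2 h'
    refine h1.trans ?_
    obtain ⟨N, hN⟩ : ∃ N : Set ℝ, N = {x | ¬ Monotone fun n => ‖u n x‖ₑ} := ⟨_, rfl⟩
    have hN0 : muPos N = 0 := by rw [hN]; exact hmono
    have h2 : muPos (⋃ n, {x | s < ‖u n x‖ₑ}) ≤ muPos (⋃ n, ({x | s < ‖u n x‖ₑ} \ N)) := by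
      apply measure_mono_ae
      filter_upwards [measure_eq_zero_iff_ae_notMem.1 hN0] with x hx h
      obtain ⟨n, hn⟩ := mem_iUnion.1 h
      exact mem_iUnion.2 ⟨n, hn, hx⟩
    refine h2.trans ?_
    have hmon : Monotone fun n => ({x | s < ‖u n x‖ₑ} \ N) := by
      intro a b hab x hx
      refine ⟨?_, hx.2⟩
      have hx2 : Monotone fun n => ‖u n x‖ₑ := by
        have := hx.2
        rw [hN] at this
        simpa using this
      exact lt_of_lt_of_le hx.1 (hx2 hab)
    rw [hmon.measure_iUnion]
    refine iSup_le fun n => (measure_mono sdiff_subset).trans ?_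
    exact (rearr_le_iff (u n) t s).1 (le_iSup (fun n => rearr (u n) t) n)
  · refine iSup_le fun n => rearr_mono ?_ t
    filter_upwards [hsup] with x hx
    rw [hx]
    exact le_iSup (fun n => ‖u n x‖ₑ) n

/-- A positive decreasing function coincides with its rearrangement. -/
theorem IsPosDecreasing.rearr_ae_eq {f : LZero} (hf : IsPosDecreasing f) :
    ∀ᵐ t ∂muPos, rearr f t = ‖f t‖ₑ := by
  obtain ⟨φ, hφ, hnn, hae⟩ := hf
  have hd : ∀ s, distrib f s = muPos {x | s < ENNReal.ofReal (φ x)} := by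
    intro s
    apply measure_congr
    filter_upwards [hae, ae_restrict_mem measurableSet_Ioi] with x hx h0
    apply propext
    change s < ‖f x‖ₑ ↔ s < ENNReal.ofReal (φ x)
    rw [hx, Real.enorm_of_nonneg (hnn x h0)]
  have hle : ∀ t : ℝ, 0 < t → rearr f t ≤ ENNReal.ofReal (φ t) := by
    intro t ht
    rw [rearr_le_iff, hd, Measure.restrict_apply']
    · calc volume ({x | ENNReal.ofReal (φ t) < ENNReal.ofReal (φ x)} ∩ Ioi 0)
          ≤ volume (Ioo 0 t) := by
            apply measure_mono
            rintro x ⟨hx, hx0⟩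
            refine ⟨hx0, ?_⟩
            by_contra hxt
            exact absurd hx (not_lt.2 (ENNReal.ofReal_le_ofReal (hφ ht hx0 (not_lt.1 hxt))))
        _ = ENNReal.ofReal t := by simp
    · exact measurableSet_Ioi
  have hge : ∀ t t' : ℝ, 0 < t' → t' < t → ENNReal.ofReal (φ t) ≤ rearr f t' := by
    intro t t' ht' htt
    refine le_of_forall_lt fun s hs => ?_
    rw [lt_rearr_iff, hd]
    calc ENNReal.ofReal t' < ENNReal.ofReal t :=
          (ENNReal.ofReal_lt_ofReal_iff (ht'.trans htt)).2 htt
      _ = muPos (Ioo 0 t) := by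
          rw [Measure.restrict_apply' measurableSet_Ioi,
            inter_eq_left.2 (show Ioo 0 t ⊆ Ioi 0 from fun x hx => hx.1)]
          simp
      _ ≤ _ := by
          apply measure_mono
          intro x hx
          exact lt_of_lt_of_le hs
            (ENNReal.ofReal_le_ofReal (hφ hx.1 (ht'.trans htt) hx.2.le))
  have hcount : {t : ℝ | 0 < t ∧ rearr f t ≠ ENNReal.ofReal (φ t)}.Countable := by
    -- each gap contains a rational level, and a given level lies in the gap of one point only
    have hsub : {t : ℝ | 0 < t ∧ rearr f t ≠ ENNReal.ofReal (φ t)} ⊆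
        ⋃ q : ℚ, {t : ℝ | 0 < t ∧ rearr f t < ENNReal.ofReal q ∧
          ENNReal.ofReal q < ENNReal.ofReal (φ t)} := by
      rintro t ⟨ht, hne⟩
      have hlt := lt_of_le_of_ne (hle t ht) hne
      obtain ⟨q, hq0, hq1, hq2⟩ := ENNReal.lt_iff_exists_rat_btwn.1 hlt
      exact mem_iUnion.2 ⟨q, ht, hq1, hq2⟩
    refine Countable.mono hsub (countable_iUnion fun q => Set.Subsingleton.countable ?_)
    rintro a ⟨ha, ha1, ha2⟩ b ⟨hb, hb1, hb2⟩
    rcases lt_trichotomy a b with h | h | h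
    · exact absurd (hge b a ha h) (not_le.2 (ha1.trans hb2))
    · exact h
    · exact absurd (hge a b hb h) (not_le.2 (hb1.trans ha2))
  have hnull : muPos {t : ℝ | 0 < t ∧ rearr f t ≠ ENNReal.ofReal (φ t)} = 0 :=
    hcount.measure_zero _
  filter_upwards [hae, ae_restrict_mem measurableSet_Ioi,
    measure_eq_zero_iff_ae_notMem.1 hnull] with t h1 h2 h3
  rw [h1, Real.enorm_of_nonneg (hnn t h2)]
  by_contra h
  exact h3 ⟨h2, h⟩

/-! ### Integrals of the rearrangement over initial intervals -/

theorem restrict_muPos_Ioo (t : ℝ) : muPos.restrict (Ioo 0 t) = volume.restrict (Ioo 0 t) := by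
  rw [Measure.restrict_restrict measurableSet_Ioo,
    inter_eq_left.2 (show Ioo 0 t ⊆ Ioi 0 from fun x hx => hx.1)]

theorem lintegral_tsub_rearr (f : LZero) (s : ℝ≥0∞) :
    ∫⁻ t, (rearr f t - s) ∂muPos = ∫⁻ x, (‖f x‖ₑ - s) ∂muPos := by
  rw [lintegral_eq_lintegral_meas_ofReal_lt _ ((rearr_measurable f).sub_const s).aemeasurable,
    lintegral_eq_lintegral_meas_ofReal_lt _ ((aemeasurable_enorm f).sub_const s)]
  refine lintegral_congr fun r => ?_
  simp_rw [lt_tsub_iff_right]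
  exact muPos_lt_rearr f _

theorem lintegral_rearr_le (f : LZero) (t : ℝ) (s : ℝ≥0∞) :
    ∫⁻ r in Ioo 0 t, rearr f r ≤ ∫⁻ x, (‖f x‖ₑ - s) ∂muPos + s * ENNReal.ofReal t := by
  rw [← lintegral_tsub_rearr]
  calc ∫⁻ r in Ioo 0 t, rearr f r ≤ ∫⁻ r in Ioo 0 t, ((rearr f r - s) + s) :=
        lintegral_mono fun r => le_tsub_add
    _ = (∫⁻ r in Ioo 0 t, (rearr f r - s)) + s * ENNReal.ofReal t := by
        rw [lintegral_add_right _ measurable_const]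
        simp
    _ ≤ _ := by
        refine add_le_add_left ?_ _
        exact lintegral_mono' (Measure.restrict_mono (fun x hx => hx.1) le_rfl) le_rfl

/-- The `K`-functional of `(L¹, L^∞)`: the lower bound in `lintegral_rearr_le` over all levels `s`
is attained at `s = f* (t)`. -/
theorem lintegral_tsub_add_le_lintegral_rearr (f : LZero) (t : ℝ) :
    ∫⁻ x, (‖f x‖ₑ - rearr f t) ∂muPos + rearr f t * ENNReal.ofReal t ≤
      ∫⁻ r in Ioo 0 t, rearr f r := by
  rw [← lintegral_tsub_rearr]
  set s := rearr f t
  have h1 : ∫⁻ r, (rearr f r - s) ∂muPos = ∫⁻ r in Ioo 0 t, (rearr f r - s) := by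
    rw [← restrict_muPos_Ioo, ← lintegral_indicator measurableSet_Ioo]
    apply lintegral_congr_ae
    filter_upwards [ae_restrict_mem measurableSet_Ioi] with r hr
    by_cases hrt : r < t
    · rw [indicator_of_mem (show r ∈ Ioo 0 t from ⟨hr, hrt⟩)]
    · rw [indicator_of_notMem (fun h => hrt h.2)]
      exact tsub_eq_zero_of_le (rearr_antitone f (not_lt.1 hrt))
  have h2 : s * ENNReal.ofReal t = ∫⁻ r in Ioo 0 t, s := by simp
  rw [h1, h2, ← lintegral_add_right _ measurable_const]
  refine setLIntegral_mono' measurableSet_Ioo fun r hr => ?_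
  rw [tsub_add_cancel_of_le (rearr_antitone f hr.2.le)]

theorem lintegral_rearr_add_le (f g : LZero) (t : ℝ) :
    ∫⁻ r in Ioo 0 t, rearr (f + g) r ≤
      ∫⁻ r in Ioo 0 t, (rearr f r + rearr g r) := by
  rw [lintegral_add_left (rearr_measurable f)]
  refine (lintegral_rearr_le (f + g) t (rearr f t + rearr g t)).trans ?_
  refine le_trans ?_ (add_le_add (lintegral_tsub_add_le_lintegral_rearr f t)
    (lintegral_tsub_add_le_lintegral_rearr g t))
  have h : ∫⁻ x, (‖(f + g : LZero) x‖ₑ - (rearr f t + rearr g t)) ∂muPos ≤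
      ∫⁻ x, (‖f x‖ₑ - rearr f t) ∂muPos + ∫⁻ x, (‖g x‖ₑ - rearr g t) ∂muPos := by
    rw [← lintegral_add_left' ((aemeasurable_enorm f).sub_const _)]
    apply lintegral_mono_ae
    filter_upwards [AEEqFun.coeFn_add f g] with x hx
    rw [hx, Pi.add_apply]
    exact (tsub_le_tsub_right (enorm_add_le _ _) _).trans add_tsub_add_le_tsub_add_tsub
  calc _ ≤ (∫⁻ x, (‖f x‖ₑ - rearr f t) ∂muPos + ∫⁻ x, (‖g x‖ₑ - rearr g t) ∂muPos) +
        (rearr f t + rearr g t) * ENNReal.ofReal t := by gcongr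
    _ = _ := by ring

theorem setLIntegral_enorm_le_lintegral_rearr (f : LZero) {E : Set ℝ} {t : ℝ}
    (hE : muPos E ≤ ENNReal.ofReal t) :
    ∫⁻ x in E, ‖f x‖ₑ ∂muPos ≤ ∫⁻ r in Ioo 0 t, rearr f r := by
  refine le_trans ?_ (lintegral_tsub_add_le_lintegral_rearr f t)
  set s := rearr f t
  calc ∫⁻ x in E, ‖f x‖ₑ ∂muPos ≤ ∫⁻ x in E, ((‖f x‖ₑ - s) + s) ∂muPos :=
        lintegral_mono fun x => le_tsub_add
    _ = ∫⁻ x in E, (‖f x‖ₑ - s) ∂muPos + s * muPos E := by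
        rw [lintegral_add_right _ measurable_const]
        simp
    _ ≤ _ := by
        gcongr
        exact Measure.restrict_le_self

/-- Sets of every intermediate measure exist between `A` and `B`: apply the intermediate value theorem
to the measure of `A ∪ (B ∩ (0, x))`. -/
theorem exists_set_measure_eq {A B : Set ℝ} (hA : MeasurableSet A) (hB : MeasurableSet B)
    (hAB : A ⊆ B) {t : ℝ} (hAt : muPos A ≤ ENNReal.ofReal t)
    (hBt : ENNReal.ofReal t < muPos B) :
    ∃ E, MeasurableSet E ∧ A ⊆ E ∧ E ⊆ B ∧ muPos E = ENNReal.ofReal t := by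
  have hAfin : muPos A ≠ ∞ := (hAt.trans_lt ENNReal.ofReal_lt_top).ne
  set S : ℝ → Set ℝ := fun x => A ∪ (B ∩ Ioo 0 x)
  have hSm : ∀ x, MeasurableSet (S x) := fun x => hA.union (hB.inter measurableSet_Ioo)
  have hSfin : ∀ x, muPos (S x) ≠ ∞ := fun x => by
    refine ((measure_union_le _ _).trans_lt (ENNReal.add_lt_top.2 ⟨hAfin.lt_top, ?_⟩)).ne
    refine (measure_mono inter_subset_right).trans_lt ?_
    exact (Measure.restrict_le_self _).trans_lt (by simp)
  have hmono : Monotone S := fun x y hxy =>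
    union_subset_union_right A (inter_subset_inter_right B (Ioo_subset_Ioo_right hxy))
  set m : ℝ → ℝ := fun x => (muPos (S x)).toReal
  have hcont : Continuous m := by
    refine (LipschitzWith.of_le_add fun x y => ?_ : LipschitzWith 1 m).continuous
    have hsub : S x ⊆ S y ∪ Ico y x := by
      rintro z (hz | ⟨hz, hz0, hzx⟩)
      · exact Or.inl (Or.inl hz)
      · rcases lt_or_ge z y with h | h
        · exact Or.inl (Or.inr ⟨hz, hz0, h⟩)
        · exact Or.inr ⟨h, hzx⟩
    have h1 : muPos (S x) ≤ muPos (S y) + ENNReal.ofReal (dist x y) := by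
      refine (measure_mono hsub).trans ((measure_union_le _ _).trans ?_)
      gcongr
      refine (Measure.restrict_le_self _).trans ?_
      rw [Real.volume_Ico]
      exact ENNReal.ofReal_le_ofReal (le_abs_self _)
    have h2 := ENNReal.toReal_mono (ENNReal.add_ne_top.2 ⟨hSfin y, ENNReal.ofReal_ne_top⟩) h1
    rwa [ENNReal.toReal_add (hSfin y) ENNReal.ofReal_ne_top,
      ENNReal.toReal_ofReal dist_nonneg] at h2
  have hlim : Tendsto (fun n : ℕ => muPos (S n)) atTop (𝓝 (muPos (⋃ n : ℕ, S n))) :=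
    tendsto_measure_iUnion_atTop (fun a b hab => hmono (Nat.cast_le.2 hab))
  have hBle : muPos B ≤ muPos (⋃ n : ℕ, S n) := by
    apply measure_mono_ae
    filter_upwards [ae_restrict_mem measurableSet_Ioi] with x hx hxB
    obtain ⟨n, hn⟩ := exists_nat_gt x
    exact mem_iUnion.2 ⟨n, Or.inr ⟨hxB, hx, hn⟩⟩
  obtain ⟨n, hn⟩ := (hlim.eventually (lt_mem_nhds (hBt.trans_le hBle))).exists
  have h0 : m 0 ≤ (ENNReal.ofReal t).toReal :=
    ENNReal.toReal_mono ENNReal.ofReal_ne_top (by simpa [S] using hAt)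
  have h1 : (ENNReal.ofReal t).toReal ≤ m n := ENNReal.toReal_mono (hSfin n) hn.le
  obtain ⟨x, hx⟩ := mem_range_of_exists_le_of_exists_ge hcont ⟨0, h0⟩ ⟨n, h1⟩
  refine ⟨S x, hSm x, subset_union_left, union_subset hAB inter_subset_left, ?_⟩
  exact (ENNReal.toReal_eq_toReal_iff' (hSfin x) ENNReal.ofReal_ne_top).1 hx

/-- Resonance: the integral of `f*` over `(0, t)` is at most the supremum of the integrals of `|f|`
over the sets of measure at most `t`. The extremal set lies between `{|f| > f* (t)}` and
`{|f| > a}` for a level `a` just below `f* (t)`. -/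
theorem lintegral_rearr_le_of_forall_set (f : LZero) {t : ℝ} {B : ℝ≥0∞}
    (hB : ∀ E, MeasurableSet E → muPos E ≤ ENNReal.ofReal t → ∫⁻ x in E, ‖f x‖ₑ ∂muPos ≤ B) :
    ∫⁻ r in Ioo 0 t, rearr f r ≤ B := by
  set s := rearr f t with hs
  refine (lintegral_rearr_le f t s).trans ?_
  have hmeas : ∀ a : ℝ≥0∞, MeasurableSet {x | a < ‖f x‖ₑ} := fun a =>
    measurableSet_lt measurable_const f.measurable.enorm
  have hA : muPos {x | s < ‖f x‖ₑ} ≤ ENNReal.ofReal t := distrib_rearr_le f t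
  have hsplit : ∀ E, {x | s < ‖f x‖ₑ} ⊆ E →
      ∫⁻ x, (‖f x‖ₑ - s) ∂muPos ≤ ∫⁻ x in E, (‖f x‖ₑ - s) ∂muPos := by
    intro E hE
    have : ∫⁻ x, (‖f x‖ₑ - s) ∂muPos = ∫⁻ x in {x | s < ‖f x‖ₑ}, (‖f x‖ₑ - s) ∂muPos := by
      rw [← lintegral_indicator (hmeas s)]
      refine lintegral_congr fun x => ?_
      by_cases hx : s < ‖f x‖ₑ
      · rw [indicator_of_mem (show x ∈ {x | s < ‖f x‖ₑ} from hx)]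
      · rw [indicator_of_notMem (show x ∉ {x | s < ‖f x‖ₑ} from hx)]
        exact tsub_eq_zero_of_le (not_lt.1 hx)
    rw [this]
    exact lintegral_mono_set hE
  rcases eq_or_ne s 0 with h0 | h0
  · rw [h0, zero_mul, add_zero, ← h0]
    refine (hsplit _ subset_rfl).trans (le_trans ?_ (hB _ (hmeas s) hA))
    exact lintegral_mono fun x => tsub_le_self
  · have key : ∀ a < s, ∫⁻ x, (‖f x‖ₑ - s) ∂muPos + a * ENNReal.ofReal t ≤ B := by
      intro a ha
      have hBa : ENNReal.ofReal t < muPos {x | a < ‖f x‖ₑ} := (lt_rearr_iff f t a).1 ha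
      obtain ⟨E, hE, hAE, hEB, hEt⟩ := exists_set_measure_eq (hmeas s) (hmeas a)
        (fun x (hx : s < ‖f x‖ₑ) => ha.trans hx) hA hBa
      refine le_trans ?_ (hB E hE hEt.le)
      calc ∫⁻ x, (‖f x‖ₑ - s) ∂muPos + a * ENNReal.ofReal t
          ≤ ∫⁻ x in E, (‖f x‖ₑ - s) ∂muPos + ∫⁻ x in E, a ∂muPos := by
            rw [setLIntegral_const, hEt]
            exact add_le_add_left (hsplit E hAE) _
        _ = ∫⁻ x in E, ((‖f x‖ₑ - s) + a) ∂muPos :=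
            (lintegral_add_right _ measurable_const).symm
        _ ≤ _ := by
            refine setLIntegral_mono' hE fun x hx => ?_
            have hax : a < ‖f x‖ₑ := hEB hx
            rcases le_total ‖f x‖ₑ s with h | h
            · rw [tsub_eq_zero_of_le h, zero_add]
              exact hax.le
            · calc ‖f x‖ₑ - s + a ≤ ‖f x‖ₑ - s + s := by gcongr
                _ = _ := tsub_add_cancel_of_le h
    have hlim : Tendsto (fun a => ∫⁻ x, (‖f x‖ₑ - s) ∂muPos + a * ENNReal.ofReal t) (𝓝[<] s)
        (𝓝 (∫⁻ x, (‖f x‖ₑ - s) ∂muPos + s * ENNReal.ofReal t)) := by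
      refine Tendsto.mono_left ?_ nhdsWithin_le_nhds
      exact tendsto_const_nhds.add
        (ENNReal.Tendsto.mul_const tendsto_id (Or.inr ENNReal.ofReal_ne_top))
    have : (𝓝[<] s).NeBot := nhdsLT_neBot_of_exists_lt ⟨0, pos_iff_ne_zero.2 h0⟩
    refine le_of_tendsto hlim ?_
    filter_upwards [self_mem_nhdsWithin] with a ha
    exact key a ha

/-! ### Hardy's lemma -/

theorem setLIntegral_ofReal_lt_le_liminf {a : ℝ → ℝ≥0∞} {b : ℕ → ℝ → ℝ≥0∞}
    (h : ∀ t : ℝ, 0 < t → ∫⁻ r in Ioo 0 t, a r ≤ liminf (fun n => ∫⁻ r in Ioo 0 t, b n r) atTop)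
    (c : ℝ≥0∞) :
    ∫⁻ r in {r | ENNReal.ofReal r < c}, a r ∂muPos ≤
      liminf (fun n => ∫⁻ r in {r | ENNReal.ofReal r < c}, b n r ∂muPos) atTop := by
  rcases eq_or_ne c ∞ with rfl | hc
  · simp only [ENNReal.ofReal_lt_top, ofPred_true, Measure.restrict_univ]
    have hunion : ⋃ n : ℕ, Ioo (0 : ℝ) n = Ioi 0 := by
      ext x
      simp only [mem_iUnion, mem_Ioo, mem_Ioi, exists_and_left, and_iff_left_iff_imp]
      exact fun _ => exists_nat_gt x
    have hdir : Directed (· ⊆ ·) fun n : ℕ => Ioo (0 : ℝ) n :=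
      (show Monotone fun n : ℕ => Ioo (0 : ℝ) n from
        fun m n hmn => Ioo_subset_Ioo_right (Nat.cast_le.2 hmn)).directed_le
    rw [show ∫⁻ r, a r ∂muPos = ⨆ n : ℕ, ∫⁻ r in Ioo (0 : ℝ) n, a r by
      rw [← setLIntegral_iUnion_of_directed _ hdir, hunion]]
    refine iSup_le fun n => ?_
    rcases Nat.eq_zero_or_pos n with rfl | hn
    · simp
    · refine (h n (Nat.cast_pos.2 hn)).trans ?_
      refine liminf_le_liminf (Eventually.of_forall fun k => ?_)
      exact lintegral_mono' (Measure.restrict_mono (fun x hx => hx.1) le_rfl) le_rfl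
  · have hset : ∀ u : ℝ → ℝ≥0∞, ∫⁻ r in {r | ENNReal.ofReal r < c}, u r ∂muPos =
        ∫⁻ r in Ioo 0 c.toReal, u r := by
      intro u
      rw [Measure.restrict_restrict
        (measurableSet_lt ENNReal.measurable_ofReal measurable_const)]
      congr 2
      ext t
      constructor
      · rintro ⟨h1, h2⟩
        exact ⟨h2, (ENNReal.ofReal_lt_iff_lt_toReal (le_of_lt h2) hc).1 h1⟩
      · rintro ⟨h1, h2⟩
        exact ⟨(ENNReal.ofReal_lt_iff_lt_toReal h1.le hc).2 h2, h1⟩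
    simp_rw [hset]
    rcases eq_or_lt_of_le (ENNReal.toReal_nonneg (a := c)) with h0 | h0
    · rw [← h0]
      simp
    · exact h _ h0

/-- Hardy's lemma, in a form that also allows a lower limit of the dominating functions: by the
layer cake formula, integrals against a decreasing weight are mixtures of integrals over initial
intervals. -/
theorem hardy_liminf {a : ℝ → ℝ≥0∞} {b : ℕ → ℝ → ℝ≥0∞} {g : LZero} (hg : IsPosDecreasing g)
    (ha : AEMeasurable a muPos) (hb : ∀ n, AEMeasurable (b n) muPos)
    (h : ∀ t : ℝ, 0 < t →
      ∫⁻ r in Ioo 0 t, a r ≤ liminf (fun n => ∫⁻ r in Ioo 0 t, b n r) atTop) :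
    ∫⁻ r, a r * ‖g r‖ₑ ∂muPos ≤ liminf (fun n => ∫⁻ r, b n r * ‖g r‖ₑ ∂muPos) atTop := by
  have hcake : ∀ u : ℝ → ℝ≥0∞, AEMeasurable u muPos → ∫⁻ r, u r * ‖g r‖ₑ ∂muPos =
      ∫⁻ s in Ioi (0 : ℝ), ∫⁻ r in {r | ENNReal.ofReal r < distrib g (ENNReal.ofReal s)},
        u r ∂muPos := by
    intro u hu
    have h1 : ∫⁻ r, u r * ‖g r‖ₑ ∂muPos = ∫⁻ r, rearr g r ∂(muPos.withDensity u) := by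
      rw [lintegral_withDensity_eq_lintegral_mul₀ hu (rearr_measurable g).aemeasurable]
      apply lintegral_congr_ae
      filter_upwards [hg.rearr_ae_eq] with r hr
      rw [Pi.mul_apply, hr]
    rw [h1, lintegral_eq_lintegral_meas_ofReal_lt _ (rearr_measurable g).aemeasurable]
    refine lintegral_congr fun s => ?_
    simp_rw [lt_rearr_iff]
    exact withDensity_apply _ (measurableSet_lt ENNReal.measurable_ofReal measurable_const)
  simp_rw [hcake a ha, fun n => hcake (b n) (hb n)]
  refine le_trans (lintegral_mono fun s => setLIntegral_ofReal_lt_le_liminf h _) ?_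
  refine lintegral_liminf_le fun n => ?_
  refine Antitone.measurable fun s s' hss => lintegral_mono_set fun r hr => ?_
  exact lt_of_lt_of_le hr (distrib_antitone g (ENNReal.ofReal_le_ofReal hss))

theorem hardy_lemma {a b : ℝ → ℝ≥0∞} {g : LZero} (hg : IsPosDecreasing g)
    (ha : AEMeasurable a muPos) (hb : AEMeasurable b muPos)
    (h : ∀ t : ℝ, 0 < t → ∫⁻ r in Ioo 0 t, a r ≤ ∫⁻ r in Ioo 0 t, b r) :
    ∫⁻ r, a r * ‖g r‖ₑ ∂muPos ≤ ∫⁻ r, b r * ‖g r‖ₑ ∂muPos := by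
  simpa using hardy_liminf (b := fun _ => b) hg ha (fun _ => hb) (by simpa using h)

theorem lintegral_mul_le_lintegral_rearr_mul (f : LZero) {g : LZero} (hg : IsPosDecreasing g) :
    ∫⁻ x, ‖f x‖ₑ * ‖g x‖ₑ ∂muPos ≤ ∫⁻ x, rearr f x * ‖g x‖ₑ ∂muPos := by
  refine hardy_lemma hg (aemeasurable_enorm f) (rearr_measurable f).aemeasurable fun t _ => ?_
  rw [← restrict_muPos_Ioo]
  refine (setLIntegral_enorm_le_lintegral_rearr f ?_).trans_eq (by rw [restrict_muPos_Ioo])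
  exact (Measure.restrict_le_self _).trans (by simp)

theorem lintegral_rearr_add_mul_le (f₁ f₂ : LZero) {g : LZero} (hg : IsPosDecreasing g) :
    ∫⁻ x, rearr (f₁ + f₂) x * ‖g x‖ₑ ∂muPos ≤
      ∫⁻ x, rearr f₁ x * ‖g x‖ₑ ∂muPos + ∫⁻ x, rearr f₂ x * ‖g x‖ₑ ∂muPos := by
  refine (hardy_lemma hg (rearr_measurable _).aemeasurable
    ((rearr_measurable f₁).add (rearr_measurable f₂)).aemeasurable
    fun t _ => lintegral_rearr_add_le f₁ f₂ t).trans_eq ?_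
  simp_rw [Pi.add_apply, add_mul]
  exact lintegral_add_left' ((rearr_measurable f₁).aemeasurable.mul (aemeasurable_enorm g)) _

/-! ### Functions of `L¹ ∩ L^∞` and of `L¹ + L^∞` -/

/-- The class of a measurable function. -/
def toLZero (u : ℝ → ℝ) (hu : Measurable u) : LZero := AEEqFun.mk u hu.aestronglyMeasurable

theorem coe_toLZero {u : ℝ → ℝ} (hu : Measurable u) : toLZero u hu =ᵐ[muPos] u :=
  AEEqFun.coeFn_mk u hu.aestronglyMeasurable

theorem coe_chi {E : Set ℝ} (hE : MeasurableSet E) :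
    chi E hE =ᵐ[muPos] E.indicator fun _ => (1 : ℝ) :=
  AEEqFun.coeFn_mk _ _

theorem eLpNorm_one_eq (f : LZero) : eLpNorm f 1 muPos = ∫⁻ x, ‖f x‖ₑ ∂muPos :=
  eLpNorm_one_eq_lintegral_enorm

theorem mem_LpSubmodule_one_iff (f : LZero) :
    f ∈ Lp.LpSubmodule ℝ ℝ 1 muPos ↔ ∫⁻ x, ‖f x‖ₑ ∂muPos < ∞ := by
  rw [← eLpNorm_one_eq]
  exact Lp.mem_Lp_iff_eLpNorm_lt_top

theorem mem_LpSubmodule_top_of_bound {f : LZero} {C : ℝ≥0∞} (hC : C ≠ ∞)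
    (h : ∀ᵐ x ∂muPos, ‖f x‖ₑ ≤ C) : f ∈ Lp.LpSubmodule ℝ ℝ ∞ muPos := by
  refine Lp.mem_Lp_iff_eLpNorm_lt_top.2 ?_
  rw [eLpNorm_exponent_top]
  exact (essSup_le_of_ae_le C h).trans_lt hC.lt_top

theorem mem_LOneInterLInf_of_bound {f : LZero} {C : ℝ≥0∞} (hC : C ≠ ∞) {E : Set ℝ}
    (hE : MeasurableSet E) (hfin : muPos E < ∞)
    (h : ∀ᵐ x ∂muPos, ‖f x‖ₑ ≤ E.indicator (fun _ => C) x) : f ∈ LOneInterLInf := by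
  refine ⟨(mem_LpSubmodule_one_iff f).2 ?_, mem_LpSubmodule_top_of_bound hC ?_⟩
  · refine (lintegral_mono_ae h).trans_lt ?_
    rw [lintegral_indicator_const hE]
    exact ENNReal.mul_lt_top hC.lt_top hfin
  · filter_upwards [h] with x hx
    exact hx.trans (indicator_le_self' (fun _ _ => zero_le) x)

theorem muPos_Ioo_lt_top (t : ℝ) : muPos (Ioo 0 t) < ∞ :=
  (Measure.restrict_le_self _).trans_lt (by simp)

theorem enorm_indicator_one (E : Set ℝ) (x : ℝ) :
    ‖E.indicator (fun _ => (1 : ℝ)) x‖ₑ = E.indicator (fun _ => (1 : ℝ≥0∞)) x := by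
  by_cases hx : x ∈ E <;> simp [hx]

theorem chi_mem_LOneInterLInf {E : Set ℝ} (hE : MeasurableSet E) (hfin : muPos E < ∞) :
    chi E hE ∈ LOneInterLInf := by
  refine mem_LOneInterLInf_of_bound ENNReal.one_ne_top hE hfin ?_
  filter_upwards [coe_chi hE] with x hx
  rw [hx, enorm_indicator_one]

theorem isPosDecreasing_chi (t : ℝ) : IsPosDecreasing (chi (Ioo 0 t) measurableSet_Ioo) := by
  refine ⟨_, fun x hx y hy hxy => ?_, fun x _ => indicator_nonneg (fun _ _ => zero_le_one) x,
    coe_chi _⟩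
  by_cases hyt : y < t
  · rw [indicator_of_mem (show x ∈ Ioo 0 t from ⟨hx, hxy.trans_lt hyt⟩),
      indicator_of_mem (show y ∈ Ioo 0 t from ⟨hy, hyt⟩)]
  · rw [indicator_of_notMem (fun h : y ∈ Ioo 0 t => hyt h.2)]
    exact indicator_nonneg (fun _ _ => zero_le_one) x

theorem lintegral_rearr_mul_chi (f : LZero) (t : ℝ) :
    ∫⁻ x, rearr f x * ‖chi (Ioo 0 t) measurableSet_Ioo x‖ₑ ∂muPos =
      ∫⁻ r in Ioo 0 t, rearr f r := by
  rw [← restrict_muPos_Ioo, ← lintegral_indicator measurableSet_Ioo]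
  apply lintegral_congr_ae
  filter_upwards [coe_chi (E := Ioo 0 t) measurableSet_Ioo] with x hx
  rw [hx, enorm_indicator_one]
  by_cases h : x ∈ Ioo 0 t <;> simp [h]

/-- If `|f| ≤ C` and `f` lives on a set of measure at most `t`, then `f* ≤ C χ_(0,t)`. -/
theorem rearr_le_indicator {f : LZero} {C : ℝ≥0∞} {E : Set ℝ} {t : ℝ}
    (hEt : muPos E ≤ ENNReal.ofReal t)
    (h : ∀ᵐ x ∂muPos, ‖f x‖ₑ ≤ E.indicator (fun _ => C) x) {r : ℝ} (hr : 0 < r) :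
    rearr f r ≤ (Ioo 0 t).indicator (fun _ => C) r := by
  by_cases hrt : r < t
  · rw [indicator_of_mem (show r ∈ Ioo 0 t from ⟨hr, hrt⟩), rearr_le_iff]
    have : distrib f C ≤ muPos ∅ := by
      apply measure_mono_ae
      filter_upwards [h] with x hx hCx
      exact absurd (lt_of_lt_of_le hCx hx)
        (not_lt.2 (indicator_le_self' (fun _ _ => zero_le) x))
    exact this.trans (by simp)
  · rw [indicator_of_notMem (fun h => hrt h.2), rearr_le_iff]
    refine le_trans (measure_mono_ae ?_) (hEt.trans (ENNReal.ofReal_le_ofReal (not_lt.1 hrt)))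
    filter_upwards [h] with x hx h0
    have h0' : 0 < ‖f x‖ₑ := h0
    change x ∈ E
    by_contra hxE
    rw [indicator_of_notMem hxE] at hx
    exact absurd h0' (not_lt.2 hx)

theorem mem_LOneAddLInf_of_lintegral_rearr_ne_top {f : LZero}
    (h : ∫⁻ r in Ioo (0 : ℝ) 1, rearr f r ≠ ∞) : f ∈ LOneAddLInf := by
  set s := rearr f 1 with hs
  have hs_fin : s ≠ ∞ := by
    have h1 := lintegral_tsub_add_le_lintegral_rearr f 1
    rw [ENNReal.ofReal_one, mul_one] at h1
    exact ne_top_of_le_ne_top h (le_add_self.trans h1)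
  have hE : MeasurableSet {x | s < ‖f x‖ₑ} := measurableSet_lt measurable_const f.measurable.enorm
  set E := {x | s < ‖f x‖ₑ} with hEdef
  have hm1 : Measurable (E.indicator f) := f.measurable.indicator hE
  have hm2 : Measurable (Eᶜ.indicator f) := f.measurable.indicator hE.compl
  refine Submodule.mem_sup.2 ⟨toLZero _ hm1, ?_, toLZero _ hm2, ?_, ?_⟩
  · rw [mem_LpSubmodule_one_iff]
    have h1 : ∫⁻ x, ‖toLZero _ hm1 x‖ₑ ∂muPos = ∫⁻ x in E, ‖f x‖ₑ ∂muPos := by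
      rw [← lintegral_indicator hE]
      apply lintegral_congr_ae
      filter_upwards [coe_toLZero hm1] with x hx
      rw [hx, enorm_indicator_eq_indicator_enorm]
    rw [h1]
    refine (setLIntegral_enorm_le_lintegral_rearr f (t := 1) ?_).trans_lt h.lt_top
    exact distrib_rearr_le f 1
  · refine mem_LpSubmodule_top_of_bound hs_fin ?_
    filter_upwards [coe_toLZero hm2] with x hx
    rw [hx]
    by_cases hxE : s < ‖f x‖ₑ
    · rw [indicator_of_notMem (show x ∉ Eᶜ from fun h => h hxE)]
      simp
    · rw [indicator_of_mem (show x ∈ Eᶜ from hxE)]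
      exact not_lt.1 hxE
  · apply AEEqFun.ext
    filter_upwards [AEEqFun.coeFn_add (toLZero _ hm1) (toLZero _ hm2), coe_toLZero hm1,
      coe_toLZero hm2] with x h1 h2 h3
    rw [h1, Pi.add_apply, h2, h3]
    exact congrFun (indicator_self_add_compl E f) x

/-! ### Rearrangement invariant norms and associate functions -/

theorem IsRINorm.mono {ρ : LZero → ℝ≥0∞} (hρ : IsRINorm ρ) {f g : LZero}
    (h : ∀ᵐ x ∂muPos, ‖f x‖ₑ ≤ ‖g x‖ₑ) : ρ f ≤ ρ g :=
  hρ.rearr_mono f g fun t _ => _root_.rearr_mono h t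

theorem IsRINorm.congr_rearr {ρ : LZero → ℝ≥0∞} (hρ : IsRINorm ρ) {f g : LZero}
    (h : rearr f = rearr g) : ρ f = ρ g :=
  le_antisymm (hρ.rearr_mono f g fun t _ => (congrFun h t).le)
    (hρ.rearr_mono g f fun t _ => (congrFun h t).ge)

theorem IsRINorm.lt_top_of_bound {ρ : LZero → ℝ≥0∞} (hρ : IsRINorm ρ) {f : LZero} {C : ℝ≥0}
    {E : Set ℝ} (hE : MeasurableSet E) (hfin : muPos E < ∞)
    (h : ∀ᵐ x ∂muPos, ‖f x‖ₑ ≤ E.indicator (fun _ => (C : ℝ≥0∞)) x) : ρ f < ∞ := by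
  have h1 : ρ f ≤ ρ ((C : ℝ) • chi E hE) := by
    refine hρ.mono ?_
    filter_upwards [h, AEEqFun.coeFn_smul (C : ℝ) (chi E hE), coe_chi hE] with x h1 h2 h3
    refine h1.trans ?_
    rw [h2, Pi.smul_apply, h3, smul_eq_mul, enorm_mul, enorm_indicator_one]
    by_cases hx : x ∈ E <;> simp [hx]
  refine h1.trans_lt ?_
  rw [hρ.smul]
  exact ENNReal.mul_lt_top enorm_lt_top (hρ.chi_lt_top E hE hfin)

/-- Hölder's inequality for an r.i. space and its associate space. -/
theorem RISpace.lintegral_mul_le (X : RISpace) {f : LZero} (hf : X.nrm f < ∞) (h : LZero) :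
    ∫⁻ x, ‖h x * f x‖ₑ ∂muPos ≤ X.nrm f * X.assocNorm h := by
  rcases eq_or_ne (X.nrm f) 0 with h0 | h0
  · have hf0 : f = 0 := (X.isRINorm.eq_zero_iff f).1 h0
    have : ∫⁻ x, ‖h x * f x‖ₑ ∂muPos = 0 := by
      rw [← lintegral_zero (μ := muPos)]
      apply lintegral_congr_ae
      filter_upwards [AEEqFun.coeFn_zero (α := ℝ) (β := ℝ) (μ := muPos)] with x hx
      rw [hf0, hx]
      simp
    rw [this]
    exact zero_le
  · set c : ℝ := (X.nrm f).toReal with hc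
    have hcpos : 0 < c := ENNReal.toReal_pos h0 hf.ne
    have hce : ‖c‖ₑ = X.nrm f := by
      rw [Real.enorm_of_nonneg hcpos.le, hc, ENNReal.ofReal_toReal hf.ne]
    have hle : X.nrm (c⁻¹ • f) ≤ 1 := by
      rw [X.isRINorm.smul, ← hce, ← enorm_mul, inv_mul_cancel₀ hcpos.ne']
      simp
    calc ∫⁻ x, ‖h x * f x‖ₑ ∂muPos
        = ∫⁻ x, ‖c‖ₑ * ‖h x * (c⁻¹ • f : LZero) x‖ₑ ∂muPos := by
          apply lintegral_congr_ae
          filter_upwards [AEEqFun.coeFn_smul c⁻¹ f] with x hx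
          rw [hx, Pi.smul_apply, smul_eq_mul, ← enorm_mul]
          congr 1
          field_simp
      _ = ‖c‖ₑ * ∫⁻ x, ‖h x * (c⁻¹ • f : LZero) x‖ₑ ∂muPos :=
          lintegral_const_mul' _ _ enorm_ne_top
      _ ≤ X.nrm f * X.assocNorm h := by
          rw [hce]
          gcongr
          exact le_iSup₂ (f := fun (f : LZero) (_ : X.nrm f ≤ 1) => ∫⁻ x, ‖h x * f x‖ₑ ∂muPos)
            (c⁻¹ • f) hle

theorem RISpace.integrable_mul (X : RISpace) {f h : LZero} (hf : X.nrm f < ∞)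
    (hh : X.assocNorm h < ∞) : Integrable (fun x => f x * h x) muPos := by
  refine ⟨(f.measurable.mul h.measurable).aestronglyMeasurable, ?_⟩
  refine lt_of_le_of_lt ?_ ((X.lintegral_mul_le hf h).trans_lt (ENNReal.mul_lt_top hf hh))
  exact (lintegral_congr fun x => by rw [mul_comm]).le

theorem enorm_integral_mul_le (X : RISpace) {f : LZero} (hf : X.nrm f < ∞) (h : LZero) :
    ‖∫ x, f x * h x ∂muPos‖ₑ ≤ X.nrm f * X.assocNorm h := by
  refine (enorm_integral_le_lintegral_enorm _).trans ((lintegral_congr fun x => ?_).trans_le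
    (X.lintegral_mul_le hf h))
  rw [mul_comm]

theorem IsPosDecreasing.nonneg {f : LZero} (hf : IsPosDecreasing f) : ∀ᵐ x ∂muPos, 0 ≤ f x := by
  obtain ⟨φ, -, hnn, hae⟩ := hf
  filter_upwards [hae, ae_restrict_mem measurableSet_Ioi] with x h1 h2
  rw [h1]
  exact hnn x h2

/-- For a positive decreasing image `T f` the duality between `T` and `T'` bounds the pairing of
`T f` with a decreasing function. -/
theorem IsAssociate.lintegral_mul_le {X : RISpace} {T : X.carrier →ₗ[ℝ] LOneAddLInf} {g h : LZero}
    (hgh : IsAssociate X T g h) (hg : IsPosDecreasing g) (f : X.carrier)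
    (hf : IsPosDecreasing (T f)) :
    ∫⁻ x, ‖(T f : LZero) x‖ₑ * ‖g x‖ₑ ∂muPos ≤ X.nrm f * X.assocNorm h := by
  obtain ⟨hint, heq⟩ := hgh.2 f
  have h1 : ∫⁻ x, ‖(T f : LZero) x‖ₑ * ‖g x‖ₑ ∂muPos =
      ENNReal.ofReal (∫ x, (T f : LZero) x * g x ∂muPos) := by
    rw [ofReal_integral_eq_lintegral_ofReal hint]
    · apply lintegral_congr_ae
      filter_upwards [hg.nonneg, hf.nonneg] with x hx hy
      rw [← enorm_mul, Real.enorm_of_nonneg (mul_nonneg hy hx)]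
    · filter_upwards [hg.nonneg, hf.nonneg] with x hx hy
      exact mul_nonneg hy hx
  rw [h1, heq]
  refine le_trans ?_ (enorm_integral_mul_le X f.2 h)
  rw [← ofReal_norm]
  exact ENNReal.ofReal_le_ofReal (le_abs_self _)

/-! ### The norm of the optimal range -/

theorem div_le_coe_iff {a b : ℝ≥0∞} (hb : b < ∞) (c : ℝ≥0) : a / b ≤ c ↔ a ≤ c * b :=
  ENNReal.div_le_iff_le_mul (Or.inr ENNReal.coe_ne_top) (Or.inl hb.ne)

theorem rangeNorm_eq_iSup {X : RISpace} {T : X.carrier →ₗ[ℝ] LOneAddLInf}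
    (hT' : HasAssociateOperator X T) (f : LZero) :
    rangeNorm X T f = ⨆ (g : LZero) (h : LZero) (_ : IsPosDecreasing g) (_ : IsAssociate X T g h),
        (∫⁻ t in Ioi 0, rearr f t * ‖g t‖ₑ) / X.assocNorm h := by
  apply le_antisymm
  · refine le_of_forall_gt fun r hr => ?_
    obtain ⟨c, hc1, hc2⟩ := ENNReal.lt_iff_exists_nnreal_btwn.1 hr
    refine lt_of_le_of_lt ?_ hc2
    have hbound : RangeBound X T f c := by
      intro g h hg hgh
      rw [← div_le_coe_iff hgh.1]
      refine le_trans ?_ hc1.le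
      exact le_iSup_of_le g (le_iSup_of_le h (le_iSup_of_le hg (le_iSup_of_le hgh le_rfl)))
    have hmem : f ∈ LOneAddLInf := by
      apply mem_LOneAddLInf_of_lintegral_rearr_ne_top
      obtain ⟨h, hh⟩ := hT' _ (chi_mem_LOneInterLInf measurableSet_Ioo (muPos_Ioo_lt_top 1))
      have h1 := hbound _ h (isPosDecreasing_chi 1) hh
      rw [lintegral_rearr_mul_chi] at h1
      exact (h1.trans_lt (ENNReal.mul_lt_top ENNReal.coe_lt_top hh.1)).ne
    have hpos : 0 < c := by
      rw [← ENNReal.coe_pos]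
      exact lt_of_le_of_lt zero_le hc1
    exact iInf₂_le c ⟨hmem, hpos, hbound⟩
  · refine le_iInf₂ fun c hc => ?_
    refine iSup_le fun g => iSup_le fun h => iSup_le fun hg => iSup_le fun hgh => ?_
    rw [div_le_coe_iff hgh.1]
    exact hc.2.2 g h hg hgh

theorem rangeSpace_eq_setOf_lt_top (X : RISpace) (T : X.carrier →ₗ[ℝ] LOneAddLInf) :
    rangeSpace X T = {f | rangeNorm X T f < ∞} := by
  ext f
  simp only [rangeSpace, rangeNorm, mem_ofPred_eq, iInf_lt_iff]
  exact ⟨fun ⟨h1, c, h2, h3⟩ => ⟨c, ⟨h1, h2, h3⟩, ENNReal.coe_lt_top⟩,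
    fun ⟨c, ⟨h1, h2, h3⟩, _⟩ => ⟨h1, c, h2, h3⟩⟩

section

variable {X : RISpace} {T : X.carrier →ₗ[ℝ] LOneAddLInf}

theorem rangeNorm_le_iff (hT' : HasAssociateOperator X T) {f : LZero} {c : ℝ≥0} :
    rangeNorm X T f ≤ c ↔ RangeBound X T f c := by
  rw [rangeNorm_eq_iSup hT']
  simp only [iSup_le_iff]
  exact ⟨fun H g h hg hgh => (div_le_coe_iff hgh.1 c).1 (H g h hg hgh),
    fun H g h hg hgh => (div_le_coe_iff hgh.1 c).2 (H g h hg hgh)⟩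

theorem lintegral_rearr_mul_le_rangeNorm (hT' : HasAssociateOperator X T) {f g h : LZero}
    (hf : rangeNorm X T f < ∞) (hg : IsPosDecreasing g) (hgh : IsAssociate X T g h) :
    ∫⁻ t, rearr f t * ‖g t‖ₑ ∂muPos ≤ rangeNorm X T f * X.assocNorm h := by
  lift rangeNorm X T f to ℝ≥0 using hf.ne with c hc
  exact (rangeNorm_le_iff hT').1 hc.ge g h hg hgh

/-- Testing with `g = χ_(0,t)` bounds `∫₀ᵗ f*` by the norm of the range. -/
theorem exists_lintegral_rearr_le_rangeNorm (hT' : HasAssociateOperator X T) (t : ℝ) :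
    ∃ C : ℝ≥0, ∀ f, ∫⁻ r in Ioo 0 t, rearr f r ≤ C * rangeNorm X T f := by
  obtain ⟨h, hh⟩ := hT' _ (chi_mem_LOneInterLInf measurableSet_Ioo (muPos_Ioo_lt_top t))
  -- adding one keeps the bound `C * ∞` infinite
  refine ⟨(X.assocNorm h).toNNReal + 1, fun f => ?_⟩
  rcases eq_or_ne (rangeNorm X T f) ∞ with h0 | h0
  · rw [h0, ENNReal.mul_top (by simp)]
    exact le_top
  · rw [← lintegral_rearr_mul_chi]
    refine (lintegral_rearr_mul_le_rangeNorm hT' h0.lt_top (isPosDecreasing_chi t) hh).trans ?_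
    rw [mul_comm, ENNReal.coe_add, ENNReal.coe_toNNReal hh.1.ne]
    gcongr
    exact le_self_add

theorem lintegral_le_of_hardy_le {f F : LZero} (hf : IsPosDecreasing f)
    (hfi : ∫⁻ x, ‖f x‖ₑ ∂muPos < ∞) {s : ℝ} (hs : 0 < s) (h : hardy f s ≤ hardy F s) :
    ∫⁻ x in Ioo 0 s, ‖f x‖ₑ ≤ ∫⁻ x in Ioo 0 s, ‖F x‖ₑ := by
  have h1 : ∫ x in Ioo 0 s, f x ≤ ∫ x in Ioo 0 s, F x :=
    le_of_mul_le_mul_left h (inv_pos.2 hs)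
  have hint : IntegrableOn f (Ioo 0 s) := by
    rw [IntegrableOn, ← restrict_muPos_Ioo]
    exact Integrable.mono_measure ⟨f.aestronglyMeasurable, hfi⟩ Measure.restrict_le_self
  have hnn : ∀ᵐ x ∂volume.restrict (Ioo 0 s), 0 ≤ f x := by
    rw [← restrict_muPos_Ioo]
    exact ae_restrict_of_ae hf.nonneg
  calc ∫⁻ x in Ioo 0 s, ‖f x‖ₑ = ENNReal.ofReal (∫ x in Ioo 0 s, f x) := by
        rw [ofReal_integral_eq_lintegral_ofReal hint hnn]
        apply lintegral_congr_ae
        filter_upwards [hnn] with x hx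
        exact Real.enorm_of_nonneg hx
    _ ≤ ENNReal.ofReal (∫ x in Ioo 0 s, F x) := ENNReal.ofReal_le_ofReal h1
    _ ≤ ‖∫ x in Ioo 0 s, F x‖ₑ := by
        rw [← ofReal_norm]
        exact ENNReal.ofReal_le_ofReal (le_abs_self _)
    _ ≤ _ := enorm_integral_le_lintegral_enorm _

/-- The lower estimate `S χ ≤ S T χ` transfers the norm of characteristic functions from `X` to the
optimal range. -/
theorem rangeNorm_chi_lt_top (hT : IsClassH X T) (hT' : HasAssociateOperator X T) {E : Set ℝ}
    (hE : MeasurableSet E) (hfin : muPos E < ∞) : rangeNorm X T (chi E hE) < ∞ := by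
  set t : ℝ := (muPos E).toReal + 1 with ht
  have ht0 : 0 < t := by positivity
  have hEt : muPos E ≤ ENNReal.ofReal t := by
    rw [ENNReal.le_ofReal_iff_toReal_le hfin.ne ht0.le]
    linarith
  set χ := chi (Ioo 0 t) measurableSet_Ioo with hχ
  have hχX : X.nrm χ < ∞ := X.isRINorm.chi_lt_top _ _ (muPos_Ioo_lt_top t)
  have hχm : χ ∈ LOneInterLInf := chi_mem_LOneInterLInf _ (muPos_Ioo_lt_top t)
  have hχd : IsPosDecreasing χ := isPosDecreasing_chi t
  set f : X.carrier := ⟨χ, hχX⟩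
  have hTd : IsPosDecreasing (T f) := hT.decreasing f hχm hχd
  suffices h : rangeNorm X T (chi E hE) ≤ (X.nrm χ).toNNReal from
    h.trans_lt ENNReal.coe_lt_top
  rw [rangeNorm_le_iff hT', RangeBound, ENNReal.coe_toNNReal hχX.ne]
  intro g h hg hgh
  calc ∫⁻ r in Ioi 0, rearr (chi E hE) r * ‖g r‖ₑ
      ≤ ∫⁻ r, ‖χ r‖ₑ * ‖g r‖ₑ ∂muPos := by
        apply lintegral_mono_ae
        filter_upwards [coe_chi (E := Ioo 0 t) measurableSet_Ioo,
          ae_restrict_mem measurableSet_Ioi] with r hr hr0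
        rw [hr, enorm_indicator_one]
        gcongr
        refine rearr_le_indicator hEt ?_ hr0
        filter_upwards [coe_chi hE] with x hx
        rw [hx, enorm_indicator_one]
    _ ≤ ∫⁻ r, ‖(T f : LZero) r‖ₑ * ‖g r‖ₑ ∂muPos := by
        refine hardy_lemma hg (aemeasurable_enorm χ) (aemeasurable_enorm _) fun s hs => ?_
        exact lintegral_le_of_hardy_le hχd ((mem_LpSubmodule_one_iff χ).1 hχm.1) hs
          (hT.restricted_lower t ht0 f rfl s hs)
    _ ≤ _ := hgh.lintegral_mul_le hg f hTd

theorem isRINorm_rangeNorm (hT : IsClassH X T) (hT' : HasAssociateOperator X T) :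
    IsRINorm (rangeNorm X T) := by
  have hloc : ∀ E : Set ℝ, MeasurableSet E → muPos E < ∞ →
      ∃ C : ℝ≥0, ∀ f : LZero, ∫⁻ x in E, ‖f x‖ₑ ∂muPos ≤ C * rangeNorm X T f := by
    intro E hE hfin
    obtain ⟨C, hC⟩ := exists_lintegral_rearr_le_rangeNorm hT' (muPos E).toReal
    refine ⟨C, fun f => (setLIntegral_enorm_le_lintegral_rearr f ?_).trans (hC f)⟩
    rw [ENNReal.ofReal_toReal hfin.ne]
  have hmono : ∀ f g : LZero, (∀ t : ℝ, 0 < t → rearr f t ≤ rearr g t) →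
      rangeNorm X T f ≤ rangeNorm X T g := by
    intro f g hfg
    simp_rw [rangeNorm_eq_iSup hT']
    refine iSup_mono fun u => iSup_mono fun h => iSup_mono fun _ => iSup_mono fun _ => ?_
    refine ENNReal.div_le_div_right ?_ _
    refine setLIntegral_mono' measurableSet_Ioi fun x hx => ?_
    gcongr
    exact hfg x hx
  refine ⟨fun f => ⟨fun hf => ?_, fun hf => ?_⟩, fun c f => ?_, fun f g => ?_, hmono, ?_,
    fun E hE hfin => rangeNorm_chi_lt_top hT hT' hE hfin, hloc⟩
  · have h1 : ∀ n : ℕ, ∀ᵐ x ∂muPos, x ∈ Ioo (0 : ℝ) n → ‖f x‖ₑ = 0 := by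
      intro n
      obtain ⟨C, hC⟩ := hloc (Ioo 0 n) measurableSet_Ioo (muPos_Ioo_lt_top n)
      have h2 := hC f
      rw [hf, mul_zero, nonpos_iff_eq_zero,
        lintegral_eq_zero_iff' (aemeasurable_enorm f).restrict] at h2
      exact (ae_restrict_iff' measurableSet_Ioo).1 h2
    apply AEEqFun.ext
    filter_upwards [ae_all_iff.2 h1, AEEqFun.coeFn_zero (α := ℝ) (β := ℝ) (μ := muPos),
      ae_restrict_mem measurableSet_Ioi] with x hx h0 hpos
    obtain ⟨n, hn⟩ := exists_nat_gt x
    rw [h0]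
    exact enorm_eq_zero.1 (hx n ⟨hpos, hn⟩)
  · rw [hf, rangeNorm_eq_iSup hT']
    simp [rearr_zero]
  · simp_rw [rangeNorm_eq_iSup hT', ENNReal.mul_iSup, rearr_smul, mul_assoc]
    simp_rw [lintegral_const_mul' _ _ (enorm_ne_top (x := c)), mul_div_assoc]
  · simp_rw [rangeNorm_eq_iSup hT']
    refine iSup_le fun u => iSup_le fun h => iSup_le fun hu => iSup_le fun huh => ?_
    refine (ENNReal.div_le_div_right (lintegral_rearr_add_mul_le f g hu) _).trans ?_
    rw [ENNReal.add_div]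
    gcongr <;>
    exact le_iSup_of_le u (le_iSup_of_le h (le_iSup_of_le hu (le_iSup_of_le huh le_rfl)))
  · intro u f h0 hu hlim
    have hmonoae : ∀ᵐ x ∂muPos, Monotone fun n => ‖u n x‖ₑ := by
      have h1 : ∀ᵐ x ∂muPos, ∀ n, u n x ≤ u (n + 1) x :=
        ae_all_iff.2 fun n => AEEqFun.coeFn_le.2 (hu n.le_succ)
      filter_upwards [h1, AEEqFun.coeFn_le.2 h0,
        AEEqFun.coeFn_zero (α := ℝ) (β := ℝ) (μ := muPos)] with x h1 h2 h3
      have hm : Monotone fun n => u n x := monotone_nat_of_le_succ h1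
      have hnn : ∀ n, 0 ≤ u n x := fun n => by
        rw [h3] at h2
        exact h2.trans (hm n.zero_le)
      intro a b hab
      change ‖u a x‖ₑ ≤ ‖u b x‖ₑ
      rw [Real.enorm_of_nonneg (hnn a), Real.enorm_of_nonneg (hnn b)]
      exact ENNReal.ofReal_le_ofReal (hm hab)
    have hlim' : ∀ᵐ x ∂muPos, Tendsto (fun n => ‖u n x‖ₑ) atTop (𝓝 ‖f x‖ₑ) := by
      filter_upwards [hlim] with x hx
      exact (continuous_enorm.tendsto _).comp hx
    have hr : ∀ a b, a ≤ b → ∀ t, rearr (u a) t ≤ rearr (u b) t := fun a b hab =>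
      rearr_mono (hmonoae.mono fun x hx => hx hab)
    have hm : Monotone fun n => rangeNorm X T (u n) := fun a b hab =>
      hmono _ _ fun t _ => hr a b hab t
    refine ⟨hm, ?_⟩
    have hsup : rangeNorm X T f = ⨆ n, rangeNorm X T (u n) := by
      refine le_antisymm ?_ (iSup_le fun n => hmono _ _ fun t _ => ?_)
      · rw [rangeNorm_eq_iSup hT']
        refine iSup_le fun g => iSup_le fun h => iSup_le fun hg => iSup_le fun hgh => ?_
        have h1 : ∫⁻ t in Ioi 0, rearr f t * ‖g t‖ₑ =
            ⨆ n, ∫⁻ t in Ioi 0, rearr (u n) t * ‖g t‖ₑ := by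
          rw [← lintegral_iSup' (f := fun n t => rearr (u n) t * ‖g t‖ₑ)
            (fun n => (rearr_measurable (u n)).aemeasurable.mul (aemeasurable_enorm g))]
          · simp_rw [rearr_eq_iSup hmonoae hlim', ENNReal.iSup_mul]
          · exact ae_of_all _ fun x a b hab => mul_le_mul_left (hr a b hab x) _
        rw [h1, ENNReal.iSup_div]
        refine iSup_mono fun n => ?_
        rw [rangeNorm_eq_iSup hT']
        exact le_iSup_of_le g (le_iSup_of_le h (le_iSup_of_le hg (le_iSup_of_le hgh le_rfl)))
      · rw [rearr_eq_iSup hmonoae hlim' t]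
        exact le_iSup (fun n => rearr (u n) t) n
    rw [hsup]
    exact tendsto_atTop_iSup hm

end

/-! ### Boundedness of the operator into the optimal range -/

/-- The decreasing rearrangement as a class of real-valued functions; it is meaningful when `f*` is
finite on `(0, ∞)`. -/
def rearrFn (f : LZero) : LZero :=
  toLZero (fun t => (rearr f t).toReal) (rearr_measurable f).ennreal_toReal

theorem coe_rearrFn (f : LZero) : rearrFn f =ᵐ[muPos] fun t => (rearr f t).toReal :=
  coe_toLZero _

theorem enorm_rearrFn {f : LZero} (hf : ∀ t : ℝ, 0 < t → rearr f t ≠ ∞) :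
    ∀ᵐ t ∂muPos, ‖rearrFn f t‖ₑ = rearr f t := by
  filter_upwards [coe_rearrFn f, ae_restrict_mem measurableSet_Ioi] with t h1 h2
  rw [h1, Real.enorm_of_nonneg ENNReal.toReal_nonneg, ENNReal.ofReal_toReal (hf t h2)]

theorem rearr_rearrFn {f : LZero} (hf : ∀ t : ℝ, 0 < t → rearr f t ≠ ∞) :
    rearr (rearrFn f) = rearr f :=
  rearr_eq_of_enorm_eq_rearr (enorm_rearrFn hf)

theorem isPosDecreasing_rearrFn {f : LZero} (hf : ∀ t : ℝ, 0 < t → rearr f t ≠ ∞) :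
    IsPosDecreasing (rearrFn f) :=
  ⟨_, fun _ ha _ _ hab => ENNReal.toReal_mono (hf _ ha) (rearr_antitone f hab),
    fun _ _ => ENNReal.toReal_nonneg, coe_rearrFn f⟩

/-- A unimodular function with `f * signFn f = |f|`. -/
def signFn (u : ℝ → ℝ) (x : ℝ) : ℝ := if 0 ≤ u x then 1 else -1

theorem measurable_signFn {u : ℝ → ℝ} (hu : Measurable u) : Measurable (signFn u) :=
  Measurable.ite (measurableSet_le measurable_const hu) measurable_const measurable_const

theorem mul_signFn (u : ℝ → ℝ) (x : ℝ) : u x * signFn u x = |u x| := by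
  by_cases h : 0 ≤ u x
  · simp [signFn, h, abs_of_nonneg h]
  · simp [signFn, h, abs_of_neg (not_le.1 h)]

theorem enorm_signFn (u : ℝ → ℝ) (x : ℝ) : ‖signFn u x‖ₑ = 1 := by
  by_cases h : 0 ≤ u x <;> simp [signFn, h]

section

variable {X : RISpace} {T : X.carrier →ₗ[ℝ] LOneAddLInf}

/-- For bounded `u` supported in `(0, t)`, the class `𝓗` allows to pass from `(T u)*` to the decreasing
function `T u*`, where duality applies. -/
theorem IsClassH.lintegral_rearr_mul_le_of_bound (hT : IsClassH X T) {g h : LZero}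
    (hg : IsPosDecreasing g) (hgh : IsAssociate X T g h) (u : X.carrier) {C : ℝ≥0∞} (hC : C ≠ ∞)
    {t : ℝ} (hu : ∀ᵐ x ∂muPos, ‖(u : LZero) x‖ₑ ≤ (Ioo 0 t).indicator (fun _ => C) x) :
    ∫⁻ r, rearr (T u) r * ‖g r‖ₑ ∂muPos ≤ X.nrm u * X.assocNorm h := by
  have hle : ∀ r : ℝ, 0 < r → rearr (u : LZero) r ≤ (Ioo 0 t).indicator (fun _ => C) r :=
    fun r hr => rearr_le_indicator ((Measure.restrict_le_self _).trans (by simp)) hu hr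
  have hfin : ∀ r : ℝ, 0 < r → rearr (u : LZero) r ≠ ∞ := fun r hr =>
    ne_top_of_le_ne_top hC ((hle r hr).trans (indicator_le_self' (fun _ _ => zero_le) r))
  have hnrm : X.nrm (rearrFn u) = X.nrm u := X.isRINorm.congr_rearr (rearr_rearrFn hfin)
  set v : X.carrier := ⟨rearrFn u, hnrm.trans_lt u.2⟩
  have hum : (u : LZero) ∈ LOneInterLInf :=
    mem_LOneInterLInf_of_bound hC measurableSet_Ioo (muPos_Ioo_lt_top t) hu
  have hvm : (v : LZero) ∈ LOneInterLInf := by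
    refine mem_LOneInterLInf_of_bound hC measurableSet_Ioo (muPos_Ioo_lt_top t) ?_
    filter_upwards [enorm_rearrFn hfin, ae_restrict_mem measurableSet_Ioi] with r h1 h2
    exact h1.trans_le (hle r h2)
  have hTd : IsPosDecreasing (T v) := hT.decreasing v hvm (isPosDecreasing_rearrFn hfin)
  calc ∫⁻ r, rearr (T u) r * ‖g r‖ₑ ∂muPos
      ≤ ∫⁻ r, rearr (T v) r * ‖g r‖ₑ ∂muPos :=
        hardy_lemma hg (rearr_measurable _).aemeasurable (rearr_measurable _).aemeasurable
          (hT.hlp_monotone u v hum (coe_rearrFn u))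
    _ = ∫⁻ r, ‖(T v : LZero) r‖ₑ * ‖g r‖ₑ ∂muPos := by
        apply lintegral_congr_ae
        filter_upwards [hTd.rearr_ae_eq] with r hr
        rw [hr]
    _ ≤ X.nrm v * X.assocNorm h := hgh.lintegral_mul_le hg v hTd
    _ = _ := by rw [← hnrm]

/-- The set on which the `n`-th truncation of `f` equals `f`. -/
def truncSet (f : LZero) (n : ℕ) : Set ℝ := {x | |f x| ≤ n ∧ x < n}

theorem measurableSet_truncSet (f : LZero) (n : ℕ) : MeasurableSet (truncSet f n) :=
  (measurableSet_le (continuous_abs.measurable.comp f.measurable) measurable_const).inter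
    measurableSet_Iio

/-- The truncation `f χ_{|f| ≤ n, x < n}`. -/
def trunc (f : LZero) (n : ℕ) : LZero :=
  toLZero ((truncSet f n).indicator f) (f.measurable.indicator (measurableSet_truncSet f n))

theorem coe_trunc (f : LZero) (n : ℕ) : trunc f n =ᵐ[muPos] (truncSet f n).indicator f :=
  coe_toLZero _

theorem enorm_trunc_le (f : LZero) (n : ℕ) : ∀ᵐ x ∂muPos, ‖trunc f n x‖ₑ ≤ ‖f x‖ₑ := by
  filter_upwards [coe_trunc f n] with x hx
  rw [hx, enorm_indicator_eq_indicator_enorm]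
  exact indicator_le_self' (fun _ _ => zero_le) x

theorem enorm_trunc_le_indicator (f : LZero) (n : ℕ) :
    ∀ᵐ x ∂muPos, ‖trunc f n x‖ₑ ≤ (Ioo (0 : ℝ) n).indicator (fun _ => (n : ℝ≥0∞)) x := by
  filter_upwards [coe_trunc f n, ae_restrict_mem measurableSet_Ioi] with x hx h0
  rw [hx]
  by_cases h : x ∈ truncSet f n
  · rw [indicator_of_mem h, indicator_of_mem (show x ∈ Ioo (0 : ℝ) n from ⟨h0, h.2⟩),
      ← ofReal_norm, ← ENNReal.ofReal_natCast]
    exact ENNReal.ofReal_le_ofReal h.1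
  · rw [indicator_of_notMem h]
    simp

/-- The truncations of `f`, as elements of the space `X`. -/
def truncX (f : X.carrier) (n : ℕ) : X.carrier :=
  ⟨trunc f n, (X.isRINorm.mono (enorm_trunc_le f n)).trans_lt f.2⟩

/-- The images of the truncations converge weakly, tested against `L¹ ∩ L^∞`. -/
theorem tendsto_integral_truncX (hT' : HasAssociateOperator X T) (f : X.carrier) {k : LZero}
    (hk : k ∈ LOneInterLInf) :
    Tendsto (fun n => ∫ x, (T (truncX f n) : LZero) x * k x ∂muPos) atTop
      (𝓝 (∫ x, (T f : LZero) x * k x ∂muPos)) := by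
  obtain ⟨h, hh⟩ := hT' k hk
  simp_rw [(hh.2 _).2]
  refine tendsto_integral_of_dominated_convergence (fun x => ‖(f : LZero) x * h x‖)
    (fun n => ?_) (X.integrable_mul f.2 hh.1).norm (fun n => ?_) ?_
  · exact (X.integrable_mul (truncX f n).2 hh.1).aestronglyMeasurable
  · filter_upwards [enorm_trunc_le f n] with x hx
    rw [norm_mul, norm_mul]
    exact mul_le_mul_of_nonneg_right (enorm_le_iff_norm_le.1 hx) (norm_nonneg _)
  · filter_upwards [ae_all_iff.2 (coe_trunc (f : LZero))] with x hx
    apply tendsto_const_nhds.congr'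
    obtain ⟨N, hN⟩ := exists_nat_gt (max |(f : LZero) x| x)
    filter_upwards [eventually_ge_atTop N] with n hn
    have hn' : (N : ℝ) ≤ n := Nat.cast_le.2 hn
    change _ = trunc f n x * h x
    rw [hx n, indicator_of_mem]
    exact ⟨((le_max_left _ _).trans hN.le).trans hn', ((le_max_right _ _).trans_lt hN).trans_le hn'⟩

/-- Weak convergence passes to a lower semicontinuity of `∫₀ᵗ (T f)*` along the truncations. -/
theorem lintegral_rearr_le_liminf (hT' : HasAssociateOperator X T) (f : X.carrier) (t : ℝ) :
    ∫⁻ r in Ioo 0 t, rearr (T f) r ≤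
      liminf (fun n => ∫⁻ r in Ioo 0 t, rearr (T (truncX f n)) r) atTop := by
  refine lintegral_rearr_le_of_forall_set _ fun E hE hEt => ?_
  set F : LZero := (T f : LZero)
  have hkm : Measurable (E.indicator (signFn F)) := (measurable_signFn F.measurable).indicator hE
  set k := toLZero _ hkm
  have hkle : ∀ᵐ x ∂muPos, ‖k x‖ₑ ≤ E.indicator (fun _ => 1) x := by
    filter_upwards [coe_toLZero hkm] with x hx
    rw [hx, enorm_indicator_eq_indicator_enorm]
    exact indicator_le_indicator (enorm_signFn _ _).le
  have hk : k ∈ LOneInterLInf :=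
    mem_LOneInterLInf_of_bound ENNReal.one_ne_top hE (hEt.trans_lt ENNReal.ofReal_lt_top) hkle
  obtain ⟨h, hh⟩ := hT' k hk
  have heq : ∫⁻ x in E, ‖F x‖ₑ ∂muPos = ENNReal.ofReal (∫ x, F x * k x ∂muPos) := by
    have hprod : ∀ᵐ x ∂muPos, F x * k x = E.indicator (fun x => |F x|) x := by
      filter_upwards [coe_toLZero hkm] with x hx
      rw [hx]
      by_cases hxE : x ∈ E <;> simp [hxE, mul_signFn]
    rw [ofReal_integral_eq_lintegral_ofReal (hh.2 f).1, ← lintegral_indicator hE]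
    · apply lintegral_congr_ae
      filter_upwards [hprod] with x hx
      rw [hx]
      by_cases hxE : x ∈ E <;> simp [hxE, Real.enorm_eq_ofReal_abs]
    · filter_upwards [hprod] with x hx
      rw [hx]
      exact indicator_nonneg (fun _ _ => abs_nonneg _) x
  rw [heq, ← ((ENNReal.continuous_ofReal.tendsto _).comp
    (tendsto_integral_truncX hT' f hk)).liminf_eq]
  refine liminf_le_liminf (Eventually.of_forall fun n => ?_)
  set G : LZero := (T (truncX f n) : LZero)
  calc ENNReal.ofReal (∫ x, G x * k x ∂muPos) ≤ ‖∫ x, G x * k x ∂muPos‖ₑ := by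
        rw [← ofReal_norm]
        exact ENNReal.ofReal_le_ofReal (le_abs_self _)
    _ ≤ ∫⁻ x, ‖G x * k x‖ₑ ∂muPos := enorm_integral_le_lintegral_enorm _
    _ ≤ ∫⁻ x in E, ‖G x‖ₑ ∂muPos := by
        rw [← lintegral_indicator hE]
        apply lintegral_mono_ae
        filter_upwards [hkle] with x hx
        rw [enorm_mul]
        by_cases hxE : x ∈ E
        · rw [indicator_of_mem hxE] at hx ⊢
          exact mul_le_of_le_one_right' hx
        · rw [indicator_of_notMem hxE] at hx ⊢
          rw [nonpos_iff_eq_zero.1 hx, mul_zero]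
    _ ≤ _ := setLIntegral_enorm_le_lintegral_rearr G hEt

theorem rangeNorm_apply_le (hT : IsClassH X T) (hT' : HasAssociateOperator X T) (f : X.carrier) :
    rangeNorm X T (T f) ≤ X.nrm f := by
  have hf : X.nrm f ≠ ∞ := f.2.ne
  rw [← ENNReal.coe_toNNReal hf, rangeNorm_le_iff hT', RangeBound, ENNReal.coe_toNNReal hf]
  intro g h hg hgh
  refine (hardy_liminf hg (rearr_measurable _).aemeasurable
    (fun n => (rearr_measurable _).aemeasurable)
    fun t _ => lintegral_rearr_le_liminf hT' f t).trans ?_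
  refine liminf_le_of_le (by isBoundedDefault) fun b hb => ?_
  obtain ⟨n, hn⟩ := hb.exists
  refine hn.trans ((hT.lintegral_rearr_mul_le_of_bound hg hgh (truncX f n)
    (ENNReal.natCast_ne_top n) (enorm_trunc_le_indicator f n)).trans ?_)
  gcongr
  exact X.isRINorm.mono (enorm_trunc_le f n)

end

/-! ### Step functions on uniform grids -/

theorem measurable_floor_div (δ : ℝ) : Measurable fun x : ℝ => ⌊x / δ⌋₊ :=
  Nat.measurable_floor.comp (measurable_id.div_const δ)

/-- The step function with value `a j` on `[j δ, (j + 1) δ)`. -/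
def stepMap (δ : ℝ) : (ℕ → ℝ) →ₗ[ℝ] LZero where
  toFun a := toLZero (fun x => a ⌊x / δ⌋₊)
    ((measurable_of_countable a).comp (measurable_floor_div δ))
  map_add' a b := by
    apply AEEqFun.ext
    refine (coe_toLZero _).trans (((coe_toLZero _).add (coe_toLZero _)).symm.trans
      (AEEqFun.coeFn_add _ _).symm)
  map_smul' c a := by
    apply AEEqFun.ext
    refine (coe_toLZero _).trans (((coe_toLZero _).const_smul c).symm.trans
      (AEEqFun.coeFn_smul _ _).symm)

theorem coe_stepMap (δ : ℝ) (a : ℕ → ℝ) : stepMap δ a =ᵐ[muPos] fun x => a ⌊x / δ⌋₊ :=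
  coe_toLZero ((measurable_of_countable a).comp (measurable_floor_div δ))

theorem lintegral_floor_div {δ : ℝ} (hδ : 0 < δ) (u : ℕ → ℝ≥0∞) :
    ∫⁻ x, u ⌊x / δ⌋₊ ∂muPos = ENNReal.ofReal δ * ∑' j, u j := by
  rw [← lintegral_map (μ := muPos) (f := u) (measurable_of_countable u) (measurable_floor_div δ),
    lintegral_countable', ← ENNReal.tsum_mul_left]
  refine tsum_congr fun j => ?_
  rw [Measure.map_apply (measurable_floor_div δ) (measurableSet_singleton j), mul_comm]
  congr 1
  have h1 : muPos = volume.restrict (Ici 0) := Measure.restrict_congr_set Ioi_ae_eq_Ici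
  rw [h1, Measure.restrict_apply (measurable_floor_div δ (measurableSet_singleton j))]
  have h2 : (fun x : ℝ => ⌊x / δ⌋₊) ⁻¹' {j} ∩ Ici 0 = Ico (j * δ) ((j + 1) * δ) := by
    ext x
    simp only [mem_inter_iff, mem_preimage, mem_singleton_iff, mem_Ici, mem_Ico]
    constructor
    · rintro ⟨h, hx⟩
      rw [Nat.floor_eq_iff (div_nonneg hx hδ.le), le_div_iff₀ hδ, div_lt_iff₀ hδ] at h
      exact h
    · rintro ⟨h, h'⟩
      have hx : 0 ≤ x := le_trans (by positivity) h
      refine ⟨?_, hx⟩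
      rw [Nat.floor_eq_iff (div_nonneg hx hδ.le), le_div_iff₀ hδ, div_lt_iff₀ hδ]
      exact ⟨h, h'⟩
  rw [h2, Real.volume_Ico]
  congr 1
  ring

theorem distrib_stepMap {δ : ℝ} (hδ : 0 < δ) (a : ℕ → ℝ) (s : ℝ≥0∞) :
    distrib (stepMap δ a) s = ENNReal.ofReal δ * ∑' j, (Ioi s).indicator 1 ‖a j‖ₑ := by
  rw [← lintegral_floor_div hδ, distrib,
    ← lintegral_indicator_one (measurableSet_lt measurable_const (stepMap δ a).measurable.enorm)]
  apply lintegral_congr_ae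
  filter_upwards [coe_stepMap δ a] with x hx
  rw [← hx]
  rfl

theorem rearr_stepMap_perm {δ : ℝ} (hδ : 0 < δ) (a : ℕ → ℝ) (σ : Equiv.Perm ℕ) :
    rearr (stepMap δ (a ∘ σ)) = rearr (stepMap δ a) := by
  refine rearr_congr_distrib fun s => ?_
  rw [distrib_stepMap hδ, distrib_stepMap hδ]
  congr 1
  exact σ.tsum_eq fun j => (Ioi s).indicator 1 ‖a j‖ₑ

theorem IsRINorm.stepMap_mono {ρ : LZero → ℝ≥0∞} (hρ : IsRINorm ρ) {δ : ℝ} {a b : ℕ → ℝ}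
    (hab : ∀ j, |a j| ≤ |b j|) : ρ (stepMap δ a) ≤ ρ (stepMap δ b) := by
  refine hρ.mono ?_
  filter_upwards [coe_stepMap δ a, coe_stepMap δ b] with x h1 h2
  rw [h1, h2, Real.enorm_eq_ofReal_abs, Real.enorm_eq_ofReal_abs]
  exact ENNReal.ofReal_le_ofReal (hab _)

theorem stepMap_refine (δ : ℝ) {m : ℕ} (hm : m ≠ 0) (a : ℕ → ℝ) :
    stepMap δ a = stepMap (δ / m) fun j => a (j / m) := by
  have hm' : (m : ℝ) ≠ 0 := Nat.cast_ne_zero.2 hm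
  apply AEEqFun.ext
  filter_upwards [coe_stepMap δ a, coe_stepMap (δ / m) fun j => a (j / m)] with x h1 h2
  rw [h1, h2, ← Nat.floor_div_natCast]
  congr 2
  rw [div_div, div_mul_cancel₀ _ hm']

/-- The averages of a sequence over consecutive blocks of length `m`. -/
def blockAvg (m : ℕ) [NeZero m] (a : ℕ → ℝ) (k : ℕ) : ℝ :=
  (m : ℝ)⁻¹ * ∑ i : Fin m, a ((Nat.divModEquiv m).symm (k, i))

/-- The permutation of `ℕ` that rotates each block of length `m` by `r` places. -/
def blockRot (m : ℕ) [NeZero m] (r : Fin m) : Equiv.Perm ℕ :=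
  ((Nat.divModEquiv m).trans ((Equiv.refl ℕ).prodCongr (Equiv.addRight r))).trans
    (Nat.divModEquiv m).symm

theorem blockAvg_div (m : ℕ) [NeZero m] (a : ℕ → ℝ) :
    (fun j => blockAvg m a (j / m)) = (m : ℝ)⁻¹ • ∑ r : Fin m, a ∘ blockRot m r := by
  funext j
  rw [Pi.smul_apply, Finset.sum_apply, smul_eq_mul, blockAvg]
  congr 1
  rw [← Equiv.sum_comp (Equiv.addLeft (Nat.divModEquiv m j).2)]
  rfl

/-- Averaging over blocks does not increase an r.i. norm, since the average of a step function is
a mean of equimeasurable step functions. -/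
theorem IsRINorm.blockAvg_le {ρ : LZero → ℝ≥0∞} (hρ : IsRINorm ρ) {δ : ℝ} (hδ : 0 < δ) (m : ℕ)
    [NeZero m] (a : ℕ → ℝ) : ρ (stepMap δ (blockAvg m a)) ≤ ρ (stepMap (δ / m) a) := by
  have hm : (m : ℝ) ≠ 0 := Nat.cast_ne_zero.2 (NeZero.ne m)
  have hmpos : (0 : ℝ) < m := Nat.cast_pos.2 (Nat.pos_of_neZero m)
  rw [stepMap_refine δ (NeZero.ne m), blockAvg_div, map_smul, map_sum, hρ.smul]
  have h1 : ρ (∑ r : Fin m, stepMap (δ / m) (a ∘ blockRot m r)) ≤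
      ∑ r : Fin m, ρ (stepMap (δ / m) (a ∘ blockRot m r)) :=
    Finset.le_sum_of_subadditive ρ ((hρ.eq_zero_iff 0).2 rfl).le hρ.add_le _ _
  have h2 : ∀ r : Fin m, ρ (stepMap (δ / m) (a ∘ blockRot m r)) = ρ (stepMap (δ / m) a) := fun r =>
    hρ.congr_rearr (rearr_stepMap_perm (div_pos hδ hmpos) a _)
  simp only [h2, Finset.sum_const, Finset.card_univ, Fintype.card_fin, nsmul_eq_mul] at h1
  calc _ ≤ ‖(m : ℝ)⁻¹‖ₑ * (m * ρ (stepMap (δ / m) a)) := by gcongr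
    _ = ρ (stepMap (δ / m) a) := by
      have h3 : ((m : ℕ) : ℝ≥0∞) = ‖(m : ℝ)‖ₑ := by
        rw [Real.enorm_of_nonneg hmpos.le, ENNReal.ofReal_natCast]
      rw [← mul_assoc, h3, ← enorm_mul, inv_mul_cancel₀ hm]
      simp

/-- Step functions with finitely many steps: the extension by zero of a vector is used as the
sequence of values. -/
def stepFin (δ : ℝ) (M : ℕ) : (Fin M → ℝ) →ₗ[ℝ] LZero :=
  (stepMap δ).comp (Function.ExtendByZero.linearMap ℝ Fin.val)

theorem extend_val_lt {M : ℕ} (b : Fin M → ℝ) {k : ℕ} (hk : k < M) :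
    Function.ExtendByZero.linearMap ℝ Fin.val b k = b ⟨k, hk⟩ :=
  Function.Injective.extend_apply Fin.val_injective b (0 : ℕ → ℝ) ⟨k, hk⟩

theorem extend_val_ge {M : ℕ} (b : Fin M → ℝ) {k : ℕ} (hk : M ≤ k) :
    Function.ExtendByZero.linearMap ℝ Fin.val b k = 0 :=
  Function.extend_apply' b (0 : ℕ → ℝ) k fun ⟨i, hi⟩ => absurd i.2 (by omega)

theorem tsum_eq_sum_fin {M : ℕ} {G : ℕ → ℝ≥0∞} (hG : ∀ k, M ≤ k → G k = 0) :
    ∑' k, G k = ∑ i : Fin M, G i := by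
  rw [tsum_eq_sum (s := Finset.range M), Finset.sum_range]
  intro k hk
  exact hG k (by simpa using hk)

theorem rearr_stepFin_perm {δ : ℝ} (hδ : 0 < δ) {M : ℕ} (b : Fin M → ℝ) (σ : Equiv.Perm (Fin M)) :
    rearr (stepFin δ M (b ∘ σ)) = rearr (stepFin δ M b) := by
  refine rearr_congr_distrib fun s => ?_
  have key : ∀ b : Fin M → ℝ, distrib (stepFin δ M b) s =
      ENNReal.ofReal δ * ∑ i : Fin M, (Ioi s).indicator 1 ‖b i‖ₑ := by
    intro b
    rw [stepFin, LinearMap.comp_apply, distrib_stepMap hδ, tsum_eq_sum_fin (M := M)]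
    · simp only [extend_val_lt b (Fin.is_lt _)]
    · intro k hk
      rw [extend_val_ge b hk]
      simp
  rw [key, key]
  congr 1
  exact Equiv.sum_comp σ fun i => (Ioi s).indicator 1 ‖b i‖ₑ

theorem stepFin_bound {δ : ℝ} (hδ : 0 < δ) {M : ℕ} (b : Fin M → ℝ) :
    ∀ᵐ x ∂muPos, ‖stepFin δ M b x‖ₑ ≤
      (Ioo 0 (M * δ)).indicator (fun _ => ((∑ i, ‖b i‖₊ : ℝ≥0) : ℝ≥0∞)) x := by
  filter_upwards [coe_stepMap δ (Function.ExtendByZero.linearMap ℝ Fin.val b),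
    ae_restrict_mem measurableSet_Ioi] with x hx h0
  rw [stepFin, LinearMap.comp_apply, hx]
  rcases lt_or_ge ⌊x / δ⌋₊ M with h | h
  · rw [extend_val_lt b h, indicator_of_mem]
    · rw [enorm_eq_nnnorm, ENNReal.coe_le_coe]
      exact Finset.single_le_sum (f := fun i => ‖b i‖₊) (fun _ _ => zero_le) (Finset.mem_univ _)
    · refine ⟨h0, ?_⟩
      rw [← div_lt_iff₀ hδ]
      exact Nat.lt_of_floor_lt h
  · rw [extend_val_ge b h]
    simp

theorem IsRINorm.stepFin_lt_top {ρ : LZero → ℝ≥0∞} (hρ : IsRINorm ρ) {δ : ℝ} (hδ : 0 < δ) {M : ℕ}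
    (b : Fin M → ℝ) : ρ (stepFin δ M b) < ∞ :=
  hρ.lt_top_of_bound measurableSet_Ioo (muPos_Ioo_lt_top _) (stepFin_bound hδ b)

theorem stepFin_mem_LOneInterLInf {δ : ℝ} (hδ : 0 < δ) {M : ℕ} (b : Fin M → ℝ) :
    stepFin δ M b ∈ LOneInterLInf :=
  mem_LOneInterLInf_of_bound ENNReal.coe_ne_top measurableSet_Ioo (muPos_Ioo_lt_top _)
    (stepFin_bound hδ b)

theorem isPosDecreasing_stepFin {δ : ℝ} (hδ : 0 < δ) {M : ℕ} {b : Fin M → ℝ} (hb : Antitone b)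
    (hnn : ∀ i, 0 ≤ b i) : IsPosDecreasing (stepFin δ M b) := by
  have hnn' : ∀ k, 0 ≤ Function.ExtendByZero.linearMap ℝ Fin.val b k := fun k => by
    rcases lt_or_ge k M with h | h
    · rw [extend_val_lt b h]
      exact hnn _
    · rw [extend_val_ge b h]
  refine ⟨_, fun x _ y _ hxy => ?_, fun x _ => hnn' _, coe_stepMap δ _⟩
  have hfl : ⌊x / δ⌋₊ ≤ ⌊y / δ⌋₊ := Nat.floor_le_floor (by gcongr)
  change Function.ExtendByZero.linearMap ℝ Fin.val b _ ≤
    Function.ExtendByZero.linearMap ℝ Fin.val b _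
  rcases lt_or_ge ⌊y / δ⌋₊ M with h | h
  · rw [extend_val_lt b h, extend_val_lt b (hfl.trans_lt h)]
    exact hb hfl
  · rw [extend_val_ge b h]
    exact hnn' _

theorem IsRINorm.stepFin_mono {ρ : LZero → ℝ≥0∞} (hρ : IsRINorm ρ) {δ : ℝ} {M : ℕ}
    {a b : Fin M → ℝ} (hab : ∀ j, |a j| ≤ |b j|) : ρ (stepFin δ M a) ≤ ρ (stepFin δ M b) := by
  refine hρ.stepMap_mono fun k => ?_
  rcases lt_or_ge k M with h | h
  · rw [extend_val_lt _ h, extend_val_lt _ h]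
    exact hab _
  · rw [extend_val_ge _ h, extend_val_ge _ h]

/-- Hahn-Banach in the finite-dimensional space of step functions: the norm of a decreasing step
function is attained by a functional of norm at most one, and rearranging the coefficients of that
functional makes them positive and decreasing. -/
theorem IsRINorm.exists_dual_vector {ρ : LZero → ℝ≥0∞} (hρ : IsRINorm ρ) {δ : ℝ} (hδ : 0 < δ)
    {M : ℕ} {b : Fin M → ℝ} (hb : Antitone b) (hnn : ∀ i, 0 ≤ b i) :
    ∃ c : Fin M → ℝ, Antitone c ∧ (∀ i, 0 ≤ c i) ∧
      ρ (stepFin δ M b) ≤ ENNReal.ofReal (∑ i, b i * c i) ∧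
      ∀ a : Fin M → ℝ, ENNReal.ofReal (∑ i, a i * c i) ≤ ρ (stepFin δ M a) := by
  have hfin : ∀ a : Fin M → ℝ, ρ (stepFin δ M a) ≠ ∞ := fun a => (hρ.stepFin_lt_top hδ a).ne
  set N : (Fin M → ℝ) → ℝ := fun a => (ρ (stepFin δ M a)).toReal with hN
  have hNsmul : ∀ (r : ℝ) (a : Fin M → ℝ), N (r • a) = |r| * N a := fun r a => by
    simp only [hN]
    rw [map_smul, hρ.smul, ENNReal.toReal_mul, toReal_enorm, Real.norm_eq_abs]
  have hNadd : ∀ x y, N (x + y) ≤ N x + N y := fun x y => by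
    simp only [hN]
    rw [map_add, ← ENNReal.toReal_add (hfin x) (hfin y)]
    exact ENNReal.toReal_mono (ENNReal.add_ne_top.2 ⟨hfin x, hfin y⟩) (hρ.add_le _ _)
  obtain ⟨ℓ, hℓb, hℓ⟩ : ∃ ℓ : (Fin M → ℝ) →ₗ[ℝ] ℝ, ℓ b = N b ∧ ∀ x, ℓ x ≤ N x := by
    rcases eq_or_ne b 0 with rfl | hb0
    · refine ⟨0, ?_, fun x => ENNReal.toReal_nonneg⟩
      have := hNsmul 0 0
      simpa using this.symm
    · obtain ⟨ℓ, h1, h2⟩ := exists_extension_of_le_sublinear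
        (LinearPMap.mkSpanSingleton b (N b) hb0) N
        (fun r hr x => by rw [hNsmul, abs_of_pos hr]) hNadd (by
          rintro ⟨x, hx⟩
          obtain ⟨r, rfl⟩ := Submodule.mem_span_singleton.1 hx
          rw [LinearPMap.mkSpanSingleton'_apply, hNsmul]
          exact mul_le_mul_of_nonneg_right (le_abs_self r) ENNReal.toReal_nonneg)
      refine ⟨ℓ, ?_, h2⟩
      rw [← LinearPMap.mkSpanSingleton_apply ℝ ℝ hb0 (N b)]
      exact h1 ⟨b, Submodule.mem_span_singleton_self b⟩
  set c₀ : Fin M → ℝ := fun i => ℓ (Pi.single i 1) with hc₀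
  have hℓsum : ∀ a, ℓ a = ∑ i, a i * c₀ i := fun a => by
    rw [LinearMap.pi_apply_eq_sum_univ ℓ a]
    refine Finset.sum_congr rfl fun i _ => ?_
    have h : (fun j => if i = j then (1 : ℝ) else 0) = Pi.single i 1 := by
      funext j
      simp [Pi.single_apply, eq_comm]
    rw [h, smul_eq_mul]
  have habs : ∀ a : Fin M → ℝ, ∑ i, |a i| * |c₀ i| ≤ N a := fun a => by
    have h1 : ∑ i, |a i| * |c₀ i| = ℓ fun i => |a i| * signFn id (c₀ i) := by
      rw [hℓsum]
      refine Finset.sum_congr rfl fun i _ => ?_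
      rw [mul_assoc, mul_comm (signFn id _)]
      congr 1
      exact (mul_signFn id (c₀ i)).symm
    rw [h1]
    refine (hℓ _).trans (ENNReal.toReal_mono (hfin a) (hρ.stepFin_mono fun j => ?_))
    have h2 : |signFn id (c₀ j)| = 1 := by
      by_cases h : 0 ≤ c₀ j <;> simp [signFn, h]
    rw [abs_mul, h2, mul_one, abs_abs]
  set σ : Equiv.Perm (Fin M) := Tuple.sort fun i => OrderDual.toDual |c₀ i| with hσ
  have hanti : Antitone fun i => |c₀ (σ i)| := fun i j hij =>
    Tuple.monotone_sort (fun i => OrderDual.toDual |c₀ i|) hij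
  refine ⟨fun i => |c₀ (σ i)|, hanti, fun i => abs_nonneg _, ?_, fun a => ?_⟩
  · rw [← ENNReal.ofReal_toReal (hfin b)]
    apply ENNReal.ofReal_le_ofReal
    calc N b = ∑ i, b i * c₀ i := by rw [← hℓb, hℓsum]
      _ ≤ ∑ i, b i * |c₀ i| :=
          Finset.sum_le_sum fun i _ => mul_le_mul_of_nonneg_left (le_abs_self _) (hnn i)
      _ = ∑ i, b i * |c₀ (σ (σ.symm i))| := by simp
      _ ≤ ∑ i, b i * |c₀ (σ i)| :=
          (hb.monovary hanti).sum_mul_comp_perm_le_sum_mul (σ := σ.symm)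
  · rw [← hρ.congr_rearr (rearr_stepFin_perm hδ a σ.symm),
      ← ENNReal.ofReal_toReal (hfin (a ∘ σ.symm))]
    apply ENNReal.ofReal_le_ofReal
    refine le_trans ?_ (habs (a ∘ σ.symm))
    rw [← Equiv.sum_comp σ fun i => |(a ∘ σ.symm) i| * |c₀ i|]
    refine Finset.sum_le_sum fun i _ => ?_
    rw [Function.comp_apply, Equiv.symm_apply_apply]
    exact mul_le_mul_of_nonneg_right (le_abs_self _) (abs_nonneg _)

/-! ### Optimality of the range -/

/-- Right continuity of `f*`, along the right end points of the grid cells that contain `x`. -/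
theorem tendsto_min_rearr_grid (f : LZero) {δ : ℕ → ℝ} (hδ : ∀ n, 0 < δ n)
    (hlim : Tendsto δ atTop (𝓝 0)) {x : ℝ} (hx : 0 < x) :
    Tendsto (fun n : ℕ => min (rearr f ((⌊x / δ n⌋₊ + 1) * δ n)) n) atTop (𝓝 (rearr f x)) := by
  have hgrid : ∀ n, x ≤ (⌊x / δ n⌋₊ + 1) * δ n ∧ (⌊x / δ n⌋₊ + 1) * δ n ≤ x + δ n := fun n => by
    have h1 := (Nat.lt_floor_add_one (x / δ n)).le
    have h2 := Nat.floor_le (div_nonneg hx.le (hδ n).le)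
    rw [div_le_iff₀ (hδ n)] at h1
    rw [le_div_iff₀ (hδ n)] at h2
    exact ⟨h1, by linarith⟩
  refine tendsto_order.2 ⟨fun s hs => ?_, fun s hs => Eventually.of_forall fun n => ?_⟩
  · have h1 : ∀ᶠ n in atTop, ENNReal.ofReal (x + δ n) < distrib f s := by
      have h2 : Tendsto (fun n => ENNReal.ofReal (x + δ n)) atTop (𝓝 (ENNReal.ofReal x)) := by
        have h3 := hlim.const_add x
        rw [add_zero] at h3
        exact (ENNReal.continuous_ofReal.tendsto _).comp h3
      exact h2.eventually (gt_mem_nhds ((lt_rearr_iff f x s).1 hs))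
    obtain ⟨N, hN⟩ := ENNReal.exists_nat_gt hs.ne_top
    filter_upwards [h1, eventually_ge_atTop N] with n hn hnN
    refine lt_min ?_ (hN.trans_le (Nat.cast_le.2 hnN))
    rw [lt_rearr_iff]
    exact (ENNReal.ofReal_le_ofReal (hgrid n).2).trans_lt hn
  · exact (min_le_left _ _).trans_lt ((rearr_antitone f (hgrid n).1).trans_lt hs)

/-- A step function on a refined grid pairs with a step function on the coarse grid through its block
averages. -/
theorem lintegral_stepMap_mul_stepFin {δ : ℝ} (hδ : 0 < δ) (m : ℕ) [NeZero m] {M : ℕ} {a : ℕ → ℝ}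
    (ha : ∀ j, 0 ≤ a j) {c : Fin M → ℝ} (hc : ∀ i, 0 ≤ c i) :
    ∫⁻ x, ‖stepMap (δ / m) a x‖ₑ * ‖stepFin δ M (δ⁻¹ • c) x‖ₑ ∂muPos =
      ENNReal.ofReal (∑ i : Fin M, blockAvg m a i * c i) := by
  have hm : (m : ℝ) ≠ 0 := Nat.cast_ne_zero.2 (NeZero.ne m)
  have hmpos : (0 : ℝ) < m := Nat.cast_pos.2 (Nat.pos_of_neZero m)
  have hδm : 0 < δ / m := div_pos hδ hmpos
  set c' : ℕ → ℝ := Function.ExtendByZero.linearMap ℝ Fin.val (δ⁻¹ • c) with hc'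
  have hstep : stepFin δ M (δ⁻¹ • c) = stepMap (δ / m) fun j => c' (j / m) := by
    rw [stepFin, LinearMap.comp_apply, stepMap_refine δ (NeZero.ne m)]
  have h1 : ∫⁻ x, ‖stepMap (δ / m) a x‖ₑ * ‖stepFin δ M (δ⁻¹ • c) x‖ₑ ∂muPos =
      ∫⁻ x, (fun j => ‖a j‖ₑ * ‖c' (j / m)‖ₑ) ⌊x / (δ / m)⌋₊ ∂muPos := by
    apply lintegral_congr_ae
    filter_upwards [coe_stepMap (δ / m) a, coe_stepMap (δ / m) fun j => c' (j / m)] with x h1 h2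
    rw [hstep, h1, h2]
  rw [h1, lintegral_floor_div hδm fun j => ‖a j‖ₑ * ‖c' (j / m)‖ₑ,
    ← (Nat.divModEquiv m).symm.tsum_eq, ENNReal.tsum_prod']
  have h2 : ∀ (k : ℕ) (i : Fin m), (Nat.divModEquiv m).symm (k, i) / m = k := fun k i =>
    congrArg Prod.fst ((Nat.divModEquiv m).apply_symm_apply (k, i))
  simp only [h2, tsum_fintype, ← Finset.sum_mul]
  rw [tsum_eq_sum_fin (M := M), Finset.mul_sum, ENNReal.ofReal_sum_of_nonneg]
  · refine Finset.sum_congr rfl fun i _ => ?_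
    have h3 : ∑ j : Fin m, ‖a ((Nat.divModEquiv m).symm (i, j))‖ₑ =
        ENNReal.ofReal (∑ j : Fin m, a ((Nat.divModEquiv m).symm (i, j))) := by
      rw [ENNReal.ofReal_sum_of_nonneg fun j _ => ha _]
      exact Finset.sum_congr rfl fun j _ => Real.enorm_of_nonneg (ha _)
    have h4 : c' i = δ⁻¹ * c i := by
      rw [hc', extend_val_lt _ i.2]
      rfl
    have h5 : 0 ≤ δ⁻¹ * c i := mul_nonneg (inv_nonneg.2 hδ.le) (hc i)
    have h6 : 0 ≤ ∑ j : Fin m, a ((Nat.divModEquiv m).symm (i, j)) :=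
      Finset.sum_nonneg fun j _ => ha _
    rw [h3, h4, Real.enorm_of_nonneg h5, ← ENNReal.ofReal_mul h6, ← ENNReal.ofReal_mul hδm.le,
      blockAvg]
    congr 1
    field_simp
  · exact fun i _ => mul_nonneg (mul_nonneg (inv_nonneg.2 hmpos.le)
      (Finset.sum_nonneg fun j _ => ha _)) (hc i)
  · intro k hk
    rw [hc', extend_val_ge _ hk]
    simp

/-- A decreasing step function whose coefficients are dominated on the step functions of its own
grid lies in the unit ball of the associate space. -/
theorem IsRINorm.lintegral_rearr_mul_stepFin_le {ρ : LZero → ℝ≥0∞} (hρ : IsRINorm ρ) {δ : ℝ}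
    (hδ : 0 < δ) {M : ℕ} {c : Fin M → ℝ} (hc : ∀ i, 0 ≤ c i)
    (hdual : ∀ a : Fin M → ℝ, ENNReal.ofReal (∑ i, a i * c i) ≤ ρ (stepFin δ M a)) (F : LZero) :
    ∫⁻ x, rearr F x * ‖stepFin δ M (δ⁻¹ • c) x‖ₑ ∂muPos ≤ ρ F := by
  set g := stepFin δ M (δ⁻¹ • c)
  -- lower approximation of `F*` on the grid refined by the factor `n + 1`
  set η : ℕ → ℝ := fun n => δ / (n + 1 : ℕ) with hη
  have hηpos : ∀ n, 0 < η n := fun n => div_pos hδ (by positivity)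
  have hηlim : Tendsto η atTop (𝓝 0) :=
    (tendsto_const_div_atTop_nhds_zero_nat δ).comp (tendsto_add_atTop_nat 1)
  set a : ℕ → ℕ → ℝ := fun n j => (min (rearr F ((j + 1) * η n)) n).toReal with ha
  have hann : ∀ n j, 0 ≤ a n j := fun n j => ENNReal.toReal_nonneg
  have hval : ∀ n, ∀ᵐ x ∂muPos,
      ‖stepMap (η n) (a n) x‖ₑ = min (rearr F ((⌊x / η n⌋₊ + 1) * η n)) n := fun n => by
    filter_upwards [coe_stepMap (η n) (a n)] with x hx
    rw [hx, Real.enorm_of_nonneg (hann _ _), ENNReal.ofReal_toReal]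
    exact ne_top_of_le_ne_top (ENNReal.natCast_ne_top n) (min_le_right _ _)
  have hbound : ∀ n, ∫⁻ x, ‖stepMap (η n) (a n) x‖ₑ * ‖g x‖ₑ ∂muPos ≤ ρ F := fun n => by
    rw [lintegral_stepMap_mul_stepFin hδ (n + 1) (hann n) hc]
    refine (hdual fun i => blockAvg (n + 1) (a n) i).trans ?_
    have h1 : ρ (stepFin δ M fun i => blockAvg (n + 1) (a n) i) ≤
        ρ (stepMap δ (blockAvg (n + 1) (a n))) := by
      refine hρ.stepMap_mono fun k => ?_
      rcases lt_or_ge k M with h | h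
      · rw [extend_val_lt _ h]
      · rw [extend_val_ge _ h, abs_zero]
        exact abs_nonneg _
    refine h1.trans ((hρ.blockAvg_le hδ (n + 1) (a n)).trans (hρ.rearr_mono _ _ fun t _ => ?_))
    refine rearr_le_of_enorm_le_rearr ?_ t
    filter_upwards [hval n] with x hx
    rw [hx]
    refine (min_le_left _ _).trans (rearr_antitone F ?_)
    rw [← div_le_iff₀ (hηpos n)]
    exact (Nat.lt_floor_add_one _).le
  calc ∫⁻ x, rearr F x * ‖g x‖ₑ ∂muPos
      ≤ ∫⁻ x, liminf (fun n => ‖stepMap (η n) (a n) x‖ₑ * ‖g x‖ₑ) atTop ∂muPos := by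
        apply lintegral_mono_ae
        filter_upwards [ae_all_iff.2 hval, ae_restrict_mem measurableSet_Ioi] with x hx h0
        simp_rw [hx]
        exact (ENNReal.Tendsto.mul_const (tendsto_min_rearr_grid F hηpos hηlim h0)
          (Or.inr enorm_ne_top)).liminf_eq.ge
    _ ≤ liminf (fun n => ∫⁻ x, ‖stepMap (η n) (a n) x‖ₑ * ‖g x‖ₑ ∂muPos) atTop :=
        lintegral_liminf_le' fun n => (aemeasurable_enorm _).mul (aemeasurable_enorm g)
    _ ≤ ρ F := by
        refine liminf_le_of_le (by isBoundedDefault) fun b hb => ?_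
        obtain ⟨n, hn⟩ := hb.exists
        exact hn.trans (hbound n)

section

variable {X : RISpace} {T : X.carrier →ₗ[ℝ] LOneAddLInf}

/-- If `g` is in the unit ball of `Y'`, then `‖T' g‖_{X'}` is at most the norm of `T : X → Y`. -/
theorem IsAssociate.assocNorm_le {Y : RISpace} {C : ℝ≥0}
    (hC : ∀ f : X.carrier, Y.nrm (T f) ≤ C * X.nrm f) {g h : LZero} (hg : IsPosDecreasing g)
    (hgY : ∀ F : LZero, ∫⁻ x, rearr F x * ‖g x‖ₑ ∂muPos ≤ Y.nrm F) (hgh : IsAssociate X T g h) :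
    X.assocNorm h ≤ C := by
  refine iSup₂_le fun f hf => ?_
  have hmul : Measurable fun x => h x * f x := h.measurable.mul f.measurable
  have hm : Measurable fun x => f x * signFn (fun x => h x * f x) x :=
    f.measurable.mul (measurable_signFn hmul)
  have hle : X.nrm (toLZero _ hm) ≤ 1 := by
    refine le_trans (X.isRINorm.mono ?_) hf
    filter_upwards [coe_toLZero hm] with x hx
    rw [hx, enorm_mul, enorm_signFn, mul_one]
  set v : X.carrier := ⟨toLZero _ hm, hle.trans_lt ENNReal.one_lt_top⟩
  set G : LZero := (T v : LZero)
  obtain ⟨hint, heq⟩ := hgh.2 v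
  have hprod : ∀ᵐ x ∂muPos, (v : LZero) x * h x = |h x * f x| := by
    filter_upwards [coe_toLZero hm] with x hx
    change toLZero _ hm x * h x = _
    rw [hx, ← mul_signFn (fun x => h x * f x)]
    ring
  calc ∫⁻ x, ‖h x * f x‖ₑ ∂muPos = ENNReal.ofReal (∫ x, (v : LZero) x * h x ∂muPos) := by
        rw [ofReal_integral_eq_lintegral_ofReal (X.integrable_mul v.2 hgh.1)]
        · apply lintegral_congr_ae
          filter_upwards [hprod] with x hx
          rw [hx, Real.enorm_eq_ofReal_abs]
        · filter_upwards [hprod] with x hx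
          rw [hx]
          exact abs_nonneg _
    _ = ENNReal.ofReal (∫ x, G x * g x ∂muPos) := by rw [heq]
    _ ≤ ‖∫ x, G x * g x ∂muPos‖ₑ := by
        rw [← ofReal_norm]
        exact ENNReal.ofReal_le_ofReal (le_abs_self _)
    _ ≤ ∫⁻ x, ‖G x * g x‖ₑ ∂muPos := enorm_integral_le_lintegral_enorm _
    _ = ∫⁻ x, ‖G x‖ₑ * ‖g x‖ₑ ∂muPos := by simp_rw [enorm_mul]
    _ ≤ ∫⁻ x, rearr G x * ‖g x‖ₑ ∂muPos := lintegral_mul_le_lintegral_rearr_mul G hg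
    _ ≤ Y.nrm G := hgY G
    _ ≤ C * X.nrm v := hC v
    _ ≤ C := mul_le_of_le_one_right' hle

/-- On decreasing step functions below `f*`, the norm of `Y` is controlled by testing against one
decreasing function of the unit ball of `Y'`. -/
theorem nrm_stepFin_le (hT' : HasAssociateOperator X T) {Y : RISpace} {C : ℝ≥0}
    (hC : ∀ f : X.carrier, Y.nrm (T f) ≤ C * X.nrm f) {f : LZero} (hf : rangeNorm X T f < ∞)
    {δ : ℝ} (hδ : 0 < δ) {M : ℕ} {b : Fin M → ℝ} (hb : Antitone b) (hnn : ∀ i, 0 ≤ b i)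
    (hbf : ∀ᵐ x ∂muPos, ‖stepFin δ M b x‖ₑ ≤ rearr f x) :
    Y.nrm (stepFin δ M b) ≤ C * rangeNorm X T f := by
  obtain ⟨c, hca, hcn, hbc, hdual⟩ := Y.isRINorm.exists_dual_vector hδ hb hnn
  have hg : IsPosDecreasing (stepFin δ M (δ⁻¹ • c)) :=
    isPosDecreasing_stepFin hδ (fun i j hij => mul_le_mul_of_nonneg_left (hca hij)
      (inv_nonneg.2 hδ.le)) fun i => mul_nonneg (inv_nonneg.2 hδ.le) (hcn i)
  obtain ⟨h, hh⟩ := hT' _ (stepFin_mem_LOneInterLInf hδ (δ⁻¹ • c))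
  have hhC : X.assocNorm h ≤ C := hh.assocNorm_le hC hg
    (Y.isRINorm.lintegral_rearr_mul_stepFin_le hδ hcn hdual)
  have hext : ∀ j, 0 ≤ Function.ExtendByZero.linearMap ℝ Fin.val b j := fun j => by
    rcases lt_or_ge j M with h | h
    · rw [extend_val_lt b h]
      exact hnn _
    · rw [extend_val_ge b h]
  have hpair := lintegral_stepMap_mul_stepFin hδ 1 hext hcn
  have havg : ∀ i : Fin M, blockAvg 1 (Function.ExtendByZero.linearMap ℝ Fin.val b) i = b i :=
    fun i => by
      have h1 : (Nat.divModEquiv 1).symm ((i : ℕ), (0 : Fin 1)) = i := by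
        simp [Nat.divModEquiv]
      rw [blockAvg, Fin.sum_univ_one, h1, extend_val_lt b i.2]
      simp
  simp only [havg, Nat.cast_one, div_one] at hpair
  calc Y.nrm (stepFin δ M b) ≤ ENNReal.ofReal (∑ i, b i * c i) := hbc
    _ = ∫⁻ x, ‖stepFin δ M b x‖ₑ * ‖stepFin δ M (δ⁻¹ • c) x‖ₑ ∂muPos := hpair.symm
    _ ≤ ∫⁻ x, rearr f x * ‖stepFin δ M (δ⁻¹ • c) x‖ₑ ∂muPos := by
        apply lintegral_mono_ae
        filter_upwards [hbf] with x hx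
        gcongr
    _ ≤ rangeNorm X T f * X.assocNorm h := lintegral_rearr_mul_le_rangeNorm hT' hf hg hh
    _ ≤ C * rangeNorm X T f := by
        rw [mul_comm]
        gcongr

theorem rearr_ne_top_of_rangeNorm_lt_top (hT' : HasAssociateOperator X T) {f : LZero}
    (hf : rangeNorm X T f < ∞) {t : ℝ} (ht : 0 < t) : rearr f t ≠ ∞ := by
  obtain ⟨C, hC⟩ := exists_lintegral_rearr_le_rangeNorm hT' t
  have h1 : rearr f t * ENNReal.ofReal t < ∞ :=
    (le_add_self.trans (lintegral_tsub_add_le_lintegral_rearr f t)).trans_lt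
      ((hC f).trans_lt (ENNReal.mul_lt_top ENNReal.coe_lt_top hf))
  intro h
  rw [h, ENNReal.top_mul (ENNReal.ofReal_pos.2 ht).ne'] at h1
  exact h1.ne rfl

/-- The optimal range embeds, with the norm of `T : X → Y`, into every r.i. space `Y` that `T` maps
`X` into. The rearrangement of `f` is the increasing limit of its lower step functions on dyadic
grids. -/
theorem nrm_le_mul_rangeNorm (hT' : HasAssociateOperator X T) {Y : RISpace} {C : ℝ≥0}
    (hC : ∀ f : X.carrier, Y.nrm (T f) ≤ C * X.nrm f) {f : LZero} (hf : rangeNorm X T f < ∞) :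
    Y.nrm f ≤ C * rangeNorm X T f := by
  have hfin : ∀ t : ℝ, 0 < t → rearr f t ≠ ∞ := fun t =>
    rearr_ne_top_of_rangeNorm_lt_top hT' hf
  set δ : ℕ → ℝ := fun n => (2 ^ n)⁻¹ with hδ
  have hδpos : ∀ n, 0 < δ n := fun n => by positivity
  have hδlim : Tendsto δ atTop (𝓝 0) :=
    tendsto_inv_atTop_zero.comp (tendsto_pow_atTop_atTop_of_one_lt one_lt_two)
  set b : ∀ n : ℕ, Fin (n * 2 ^ n) → ℝ :=
    fun n i => (min (rearr f ((i + 1) * δ n)) n).toReal with hb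
  set u : ℕ → LZero := fun n => stepFin (δ n) (n * 2 ^ n) (b n) with hu
  have hmintop : ∀ (t : ℝ) (n : ℕ), min (rearr f t) n ≠ ∞ := fun t n =>
    ne_top_of_le_ne_top (ENNReal.natCast_ne_top n) (min_le_right _ _)
  have hval : ∀ᵐ x ∂muPos, ∀ n : ℕ, u n x =
      if x < n then (min (rearr f ((⌊x / δ n⌋₊ + 1) * δ n)) n).toReal else 0 := by
    rw [ae_all_iff]
    intro n
    filter_upwards [coe_stepMap (δ n) (Function.ExtendByZero.linearMap ℝ Fin.val (b n)),
      ae_restrict_mem measurableSet_Ioi] with x hx h0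
    have hiff : ⌊x / δ n⌋₊ < n * 2 ^ n ↔ x < n := by
      rw [Nat.floor_lt (div_nonneg (le_of_lt h0) (hδpos n).le), hδ, div_inv_eq_mul]
      push_cast
      exact mul_lt_mul_iff_left₀ (by positivity)
    change stepMap _ _ x = _
    rw [hx]
    split_ifs with hxn
    · rw [extend_val_lt _ (hiff.2 hxn)]
    · exact extend_val_ge _ (not_lt.1 fun h => hxn (hiff.1 h))
  have hgrid : ∀ (n : ℕ) (x : ℝ), x ≤ (⌊x / δ n⌋₊ + 1) * δ n := fun n x => by
    rw [← div_le_iff₀ (hδpos n)]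
    exact (Nat.lt_floor_add_one _).le
  have hgrid_succ : ∀ (n : ℕ) (x : ℝ), 0 < x →
      ((⌊x / δ (n + 1)⌋₊ : ℝ) + 1) * δ (n + 1) ≤ (⌊x / δ n⌋₊ + 1) * δ n := by
    intro n x hx
    have h1 : x / δ (n + 1) = 2 * (x / δ n) := by
      simp only [hδ, div_inv_eq_mul, pow_succ]
      ring
    have h2 : δ n = 2 * δ (n + 1) := by
      simp only [hδ, pow_succ]
      field_simp
    have h3 : ⌊x / δ (n + 1)⌋₊ < 2 * (⌊x / δ n⌋₊ + 1) := by
      rw [Nat.floor_lt (div_nonneg hx.le (hδpos _).le), h1]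
      push_cast
      have := Nat.lt_floor_add_one (x / δ n)
      linarith
    have h4 : ((⌊x / δ (n + 1)⌋₊ : ℝ) + 1) ≤ 2 * (⌊x / δ n⌋₊ + 1) := by exact_mod_cast h3
    calc _ ≤ (2 * ((⌊x / δ n⌋₊ : ℝ) + 1)) * δ (n + 1) :=
          mul_le_mul_of_nonneg_right h4 (hδpos _).le
      _ = _ := by rw [h2]; ring
  have hu0 : 0 ≤ u 0 := by
    rw [← AEEqFun.coeFn_le]
    filter_upwards [hval, AEEqFun.coeFn_zero (α := ℝ) (β := ℝ) (μ := muPos)] with x hx h0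
    rw [h0, hx 0]
    split_ifs
    · exact ENNReal.toReal_nonneg
    · exact le_rfl
  have humono : Monotone u := by
    refine monotone_nat_of_le_succ fun n => ?_
    rw [← AEEqFun.coeFn_le]
    filter_upwards [hval, ae_restrict_mem measurableSet_Ioi] with x hx h0
    rw [hx n, hx (n + 1)]
    have hcast : (n : ℝ) ≤ (n + 1 : ℕ) := Nat.cast_le.2 n.le_succ
    by_cases hxn : x < n
    · rw [if_pos hxn, if_pos (hxn.trans_le hcast)]
      refine ENNReal.toReal_mono (hmintop _ _) (min_le_min ?_ (Nat.cast_le.2 n.le_succ))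
      exact rearr_antitone f (hgrid_succ n x h0)
    · rw [if_neg hxn]
      split_ifs
      · exact ENNReal.toReal_nonneg
      · exact le_rfl
  have hulim : ∀ᵐ x ∂muPos, Tendsto (fun n => u n x) atTop (𝓝 (rearrFn f x)) := by
    filter_upwards [hval, coe_rearrFn f, ae_restrict_mem measurableSet_Ioi] with x hx h1 h0
    rw [h1]
    refine ((ENNReal.tendsto_toReal (hfin x h0)).comp
      (tendsto_min_rearr_grid f hδpos hδlim h0)).congr' ?_
    obtain ⟨N, hN⟩ := exists_nat_gt x
    filter_upwards [eventually_ge_atTop N] with n hn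
    rw [hx n, if_pos (hN.trans_le (Nat.cast_le.2 hn))]
    rfl
  rw [← Y.isRINorm.congr_rearr (rearr_rearrFn hfin)]
  refine le_of_tendsto' (Y.isRINorm.fatou u _ hu0 humono hulim).2 fun n => ?_
  refine nrm_stepFin_le hT' hC hf (hδpos n) (fun i j hij => ?_)
    (fun i => ENNReal.toReal_nonneg) ?_
  · refine ENNReal.toReal_mono (hmintop _ _) (min_le_min_right _ (rearr_antitone f ?_))
    have : (i : ℝ) ≤ (j : ℕ) := Nat.cast_le.2 hij
    exact mul_le_mul_of_nonneg_right (by linarith) (hδpos n).le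
  · filter_upwards [hval] with x hx
    change ‖u n x‖ₑ ≤ _
    rw [hx n]
    split_ifs
    · rw [Real.enorm_of_nonneg ENNReal.toReal_nonneg, ENNReal.ofReal_toReal (hmintop _ _)]
      exact (min_le_left _ _).trans (rearr_antitone f (hgrid n x))
    · simp

end

end

theorem theorem3p1 (X : RISpace) (T : X.carrier →ₗ[ℝ] LOneAddLInf)
    (hT : IsClassH X T) (hT' : HasAssociateOperator X T) :
    (∃ Z : RISpace, Z.nrm = rangeNorm X T ∧ (Z.carrier : Set LZero) = rangeSpace X T ∧
      IsRIOptimalRange X T Z) ∧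
    ∀ f : LZero, rangeNorm X T f =
      ⨆ (g : LZero) (h : LZero) (_ : IsPosDecreasing g) (_ : IsAssociate X T g h),
        (∫⁻ t in Ioi 0, rearr f t * ‖g t‖ₑ) / X.assocNorm h := by
  refine ⟨⟨⟨rangeNorm X T, isRINorm_rangeNorm hT hT'⟩, rfl,
    (rangeSpace_eq_setOf_lt_top X T).symm, ⟨1, fun f => ?_⟩, ?_⟩, rangeNorm_eq_iSup hT'⟩
  · rw [ENNReal.coe_one, one_mul]
    exact rangeNorm_apply_le hT hT' f
  · rintro Y ⟨C, hC⟩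
    have key : ∀ f, rangeNorm X T f < ∞ → Y.nrm f ≤ C * rangeNorm X T f := fun f hf =>
      nrm_le_mul_rangeNorm hT' hC hf
    exact ⟨fun f hf => (key f hf).trans_lt (ENNReal.mul_lt_top ENNReal.coe_lt_top hf), C,
      fun f hf => key f hf⟩
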